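/- Let $d\in\mathbb N$ and $\mathbb T^d=\mathbb R^d/2\pi\mathbb Z^d$. For $k\in\mathbb Z^d$ put $\varphi_k(x)=(2\pi)^{-d/2}e^{ik\cdot x}$ and $\lambda_k=|k|^2$, and let $$H^1(\mathbb T^d)=\Big\{w\in L^2(\mathbb T^d,\mathbb R)\;\Big|\;\sum_{k\in\mathbb Z^d}\lambda_k|\langle w,\varphi_k\rangle|^2<\infty\Big\},\qquad \|w\|_{H^1}^2=\|w\|_{L^2}^2+\sum_{k}\lambda_k|\langle w,\varphi_k\rangle|^2 .$$ Consider the controlled wave equation $$\partial_t^2 w(x,t)=\Big(\Delta+\sum_{j=0}^{2d}p_j(t)\mu_j(x)\Big)w(x,t),\qquad x\in\mathbb T^d,$$ where $(\mu_0,\dots,\mu_{2d})=(1,\cos x_1,\sin x_1,\dots,\cos x_d,\sin x_d)$ and $p=(p_0,\dots,p_{2d})$ is the control. With $\mathcal A=\begin{pmatrix}0&I\\ \Delta&0\end{pmatrix}$, $\mathcal B=\begin{pmatrix}0&0\\ I&0\end{pmatrix}$, its solution on $[0,\tau]$ with initial state $W_0=(w_0,\dot w_0)\in H^1\times L^2(\mathbb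 T^d,\mathbb R)$ is the function $W=(w,\partial_t w)\in C^0([0,\tau],H^1\times L^2)$ with $$W(t)=e^{t\mathcal A}W_0+\int_0^te^{(t-s)\mathcal A}\Big(\sum_{j=0}^{2d}p_j(s)\mu_j\mathcal B\Big)W(s)\,ds,\qquad t\in[0,\tau],$$ where the group $e^{t\mathcal A}$ on $H^1\times L^2$ is given by the Fourier series of the free wave evolution. Lemma. Let $(w_0,\dot w_0)\in H^1\times L^2(\mathbb T^d,\mathbb R)$ and $\phi\in L^2(\mathbb T^d,\mathbb R)$; if $d\ge 2$, suppose that $w_0\phi\in L^2(\mathbb T^d)$. Then $w_0\phi\in L^2(\mathbb T^d)$ (also when $d=1$), and for all $\varepsilon,T>0$ there exist $\tau\in[0,T)$ and a piecewise constant control $p:[0,\tau]\to\mathbb R^{2d+1}$ such that the solution $(w,\partial_t w)$ on $[0,\tau]$ associated with $p$ and with the initial state $(w_0,\dot w_0)$ exists and satisfies $$\left\|\begin{pmatrix}w(\cdot,\tau)\\ \partial_t w(\cdot,\tau)\end{pmatrix}-\begin{pmatrix}w_0\\ \dot w_0+w_0\phi\end{pmatrix}\right\|_{H^1\times L^2(\mathbb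 T^d)}<\varepsilon .$$ -/

import Mathlib

open MeasureTheory Set
open scoped ENNReal ComplexConjugate

noncomputable section

namespace TorusWave

instance twoPiPos : Fact (0 < 2 * Real.pi) := ⟨Real.two_pi_pos⟩

/-- The torus `ℝ^d / 2πℤ^d`, with the product of the Lebesgue measures (total mass `(2π)^d`). -/
abbrev Torus (d : ℕ) : Type := Fin d → AddCircle (2 * Real.pi)

/-- The real Hilbert space `L²(𝕋^d, ℝ)`. -/
abbrev L2 (d : ℕ) : Type := Lp ℝ 2 (volume : Measure (Torus d))

/-- The eigenfunction `φ_k(x) = (2π)^{-d/2} e^{i k·x}` of the Laplacian. -/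
def eigenfunction {d : ℕ} (k : Fin d → ℤ) : C(Torus d, ℂ) where
  toFun x := (((2 * Real.pi) ^ (-(d : ℝ) / 2) : ℝ) : ℂ) * ∏ i, fourier (k i) (x i)
  continuous_toFun := by fun_prop

/-- The eigenvalue `λ_k = |k|²` of `-Δ`. -/
def eigenvalue {d : ℕ} (k : Fin d → ℤ) : ℝ := ∑ i, (k i : ℝ) ^ 2

/-- The frequency `√λ_k = |k|`. -/
def freq {d : ℕ} (k : Fin d → ℤ) : ℝ := Real.sqrt (eigenvalue k)

/-- The Fourier coefficient `⟨w, φ_k⟩ = ∫ w(x) conj(φ_k(x)) dx`. -/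
def coeff {d : ℕ} (w : L2 d) (k : Fin d → ℤ) : ℂ :=
  ∫ x, conj (eigenfunction k x) * ((w x : ℝ) : ℂ)

theorem coeff_eq_inner {d : ℕ} (w : L2 d) (k : Fin d → ℤ) :
    coeff w k = inner ℂ (ContinuousMap.toLp (E := ℂ) 2 volume ℂ (eigenfunction k))
      (Complex.ofRealCLM.compLpL 2 (volume : Measure (Torus d)) w) := by
  rw [L2.inner_def, coeff]
  apply integral_congr_ae
  filter_upwards [ContinuousMap.coeFn_toLp (p := 2) (E := ℂ) (𝕜 := ℂ)
    (volume : Measure (Torus d)) (eigenfunction k),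
    Complex.ofRealCLM.coeFn_compLpL w] with x h1 h2
  rw [h1, h2]
  simp [mul_comm]

theorem coeff_add {d : ℕ} (v w : L2 d) (k : Fin d → ℤ) :
    coeff (v + w) k = coeff v k + coeff w k := by
  simp only [coeff_eq_inner, map_add, inner_add_right]

theorem coeff_smul {d : ℕ} (c : ℝ) (w : L2 d) (k : Fin d → ℤ) :
    coeff (c • w) k = c * coeff w k := by
  rw [coeff, coeff, ← integral_const_mul]
  apply integral_congr_ae
  filter_upwards [Lp.coeFn_smul c w] with x hx
  rw [hx]
  simp only [Pi.smul_apply, smul_eq_mul, Complex.ofReal_mul]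
  ring

theorem continuous_coeff {d : ℕ} (k : Fin d → ℤ) : Continuous fun w : L2 d => coeff w k := by
  simp only [coeff_eq_inner]
  fun_prop

/-- The functions `w ∈ L²(𝕋^d, ℝ)` with `∑_k λ_k |⟨w, φ_k⟩|² < ∞`. -/
def h1Submodule (d : ℕ) : Submodule ℝ (L2 d) where
  carrier := {w | Summable fun k => eigenvalue k * ‖coeff w k‖ ^ 2}
  zero_mem' := by
    have h : ∀ k, coeff (0 : L2 d) k = 0 := fun k => by simp [coeff_eq_inner]
    simp [h, summable_zero]
  add_mem' := by
    intro v w hv hw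
    refine Summable.of_nonneg_of_le (fun k => ?_) (fun k => ?_) ((hv.add hw).mul_left 2)
    · exact mul_nonneg (Finset.sum_nonneg fun i _ => sq_nonneg _) (sq_nonneg _)
    · have h0 : 0 ≤ eigenvalue k := Finset.sum_nonneg fun i _ => sq_nonneg _
      have h1 : ‖coeff (v + w) k‖ ^ 2 ≤ 2 * (‖coeff v k‖ ^ 2 + ‖coeff w k‖ ^ 2) := by
        rw [coeff_add]
        have h2 := norm_add_le (coeff v k) (coeff w k)
        nlinarith [norm_nonneg (coeff v k + coeff w k), sq_nonneg (‖coeff v k‖ - ‖coeff w k‖)]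
      nlinarith [mul_le_mul_of_nonneg_left h1 h0]
  smul_mem' := by
    intro c w hw
    refine (Summable.mul_left (c ^ 2) hw).congr fun k => ?_
    rw [coeff_smul, norm_mul, Complex.norm_real, mul_pow, Real.norm_eq_abs, sq_abs]
    ring

/-- The Sobolev space `H¹(𝕋^d, ℝ)`. It carries its own norm, defined below, not that of `L²`. -/
def H1 (d : ℕ) : Type := h1Submodule d

instance H1.addCommGroup (d : ℕ) : AddCommGroup (H1 d) := inferInstanceAs (AddCommGroup (h1Submodule d))

instance H1.module (d : ℕ) : Module ℝ (H1 d) := inferInstanceAs (Module ℝ (h1Submodule d))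

/-- The inclusion of `H¹` in `L²`. -/
def H1.toL2 {d : ℕ} : H1 d →ₗ[ℝ] L2 d := (h1Submodule d).subtype

theorem H1.summable {d : ℕ} (w : H1 d) :
    Summable fun k => eigenvalue k * ‖coeff w.toL2 k‖ ^ 2 := w.2

theorem eigenvalue_nonneg {d : ℕ} (k : Fin d → ℤ) : 0 ≤ eigenvalue k :=
  Finset.sum_nonneg fun _ _ => sq_nonneg _

theorem norm_freq_mul_sq {d : ℕ} (w : L2 d) (k : Fin d → ℤ) :
    ‖(freq k : ℂ) * coeff w k‖ ^ 2 = eigenvalue k * ‖coeff w k‖ ^ 2 := by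
  rw [norm_mul, Complex.norm_real, mul_pow, Real.norm_eq_abs, sq_abs, freq,
    Real.sq_sqrt (eigenvalue_nonneg k)]

/-- The sequence `(√λ_k ⟨w, φ_k⟩)_k ∈ ℓ²(ℤ^d, ℂ)` of a function `w ∈ H¹`. -/
def H1.freqSeq {d : ℕ} : H1 d →ₗ[ℝ] lp (fun _ : Fin d → ℤ => ℂ) 2 where
  toFun w := ⟨fun k => (freq k : ℂ) * coeff w.toL2 k, by
    refine memℓp_gen ?_
    refine w.summable.congr fun k => ?_
    rw [← norm_freq_mul_sq]
    simp⟩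
  map_add' v w := by
    ext k
    simp only [map_add, coeff_add, mul_add]
    rfl
  map_smul' c w := by
    ext k
    simp [coeff_smul]
    ring

/-- The map `w ↦ (w, (√λ_k ⟨w, φ_k⟩)_k)`, whose target has the norm
`‖(u, c)‖² = ‖u‖² + ∑_k |c_k|²`. -/
def H1.graph {d : ℕ} : H1 d →ₗ[ℝ] WithLp 2 (L2 d × lp (fun _ : Fin d → ℤ => ℂ) 2) :=
  (WithLp.linearEquiv 2 ℝ (L2 d × lp (fun _ : Fin d → ℤ => ℂ) 2)).symm.toLinearMap ∘ₗ
    H1.toL2.prod H1.freqSeq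

theorem H1.toL2_injective {d : ℕ} : Function.Injective (H1.toL2 (d := d)) :=
  Subtype.val_injective

theorem H1.graph_injective {d : ℕ} : Function.Injective (H1.graph (d := d)) := by
  intro v w h
  apply H1.toL2_injective
  exact congrArg (fun z => (WithLp.ofLp z).1) h

instance H1.normedAddCommGroup (d : ℕ) : NormedAddCommGroup (H1 d) :=
  NormedAddCommGroup.induced (H1 d) _ H1.graph H1.graph_injective

instance H1.normedSpace (d : ℕ) : NormedSpace ℝ (H1 d) :=
  NormedSpace.induced ℝ (H1 d) _ H1.graph

/-- The `H¹` norm: `‖w‖² = ‖w‖²_{L²} + ∑_k λ_k |⟨w, φ_k⟩|²`. -/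
theorem H1.norm_sq {d : ℕ} (w : H1 d) :
    ‖w‖ ^ 2 = ‖w.toL2‖ ^ 2 + ∑' k, eigenvalue k * ‖coeff w.toL2 k‖ ^ 2 := by
  have h : ‖w‖ = ‖H1.graph w‖ := rfl
  rw [h, WithLp.prod_norm_sq_eq_of_L2]
  congr 1
  have h2 := lp.norm_rpow_eq_tsum (p := 2) (by norm_num) (H1.freqSeq w)
  simp only [ENNReal.toReal_ofNat, Real.rpow_ofNat] at h2
  refine h2.trans (tsum_congr fun k => ?_)
  exact norm_freq_mul_sq _ _

theorem H1.isClosed_range_graph {d : ℕ} : IsClosed (range (H1.graph (d := d))) := by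
  have h : range (H1.graph (d := d)) =
      {z | ∀ k, (WithLp.ofLp z).2 k = (freq k : ℂ) * coeff (WithLp.ofLp z).1 k} := by
    ext z
    constructor
    · rintro ⟨w, rfl⟩ k
      rfl
    · intro hz
      have hs : (WithLp.ofLp z).1 ∈ h1Submodule d := by
        have := (lp.memℓp (WithLp.ofLp z).2).summable (by norm_num)
        refine this.congr fun k => ?_
        rw [hz k, ← norm_freq_mul_sq]
        simp
      refine ⟨⟨(WithLp.ofLp z).1, hs⟩, ?_⟩
      apply WithLp.ofLp_injective
      refine Prod.ext rfl ?_
      ext k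
      exact (hz k).symm
  rw [h, Set.ofPred_forall]
  refine isClosed_iInter fun k => isClosed_eq ?_ ?_
  · exact ((lp.evalCLM ℝ (fun _ : Fin d → ℤ => ℂ) 2 k).continuous).comp
      (continuous_snd.comp (WithLp.prod_continuous_ofLp 2 _ _))
  · exact continuous_const.mul ((continuous_coeff k).comp
      (continuous_fst.comp (WithLp.prod_continuous_ofLp 2 _ _)))

instance H1.completeSpace (d : ℕ) : CompleteSpace (H1 d) := by
  have hi : Isometry (H1.graph (d := d)) :=
    AddMonoidHomClass.isometry_of_norm _ fun _ => rfl
  exact (completeSpace_iff_isComplete_range hi.isUniformInducing).2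
    H1.isClosed_range_graph.isComplete

/-- The state space `H¹ × L²(𝕋^d, ℝ)`, with `‖(w, v)‖² = ‖w‖²_{H¹} + ‖v‖²_{L²}`. -/
abbrev State (d : ℕ) : Type := WithLp 2 (H1 d × L2 d)

/-- The state with profile `w` and velocity `v`. -/
abbrev mkState {d : ℕ} (w : H1 d) (v : L2 d) : State d := WithLp.toLp 2 (w, v)

theorem integral_fourier_eq_zero {n : ℤ} (hn : n ≠ 0) :
    ∫ x : AddCircle (2 * Real.pi), (fourier n x : ℂ) = 0 :=
  integral_eq_zero_of_add_right_eq_neg (fourier_add_half_inv_index hn Real.two_pi_pos)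

theorem integral_conj_eigenfunction_mul {d : ℕ} {j k : Fin d → ℤ} (h : j ≠ k) :
    ∫ x : Torus d, conj (eigenfunction j x) * eigenfunction k x = 0 := by
  obtain ⟨i, hi⟩ := Function.ne_iff.1 h
  have hx : ∀ x : Torus d, conj (eigenfunction j x) * eigenfunction k x =
      (((2 * Real.pi) ^ (-(d : ℝ) / 2) : ℝ) : ℂ) ^ 2 * ∏ l, fourier (k l - j l) (x l) := by
    intro x
    simp only [eigenfunction, ContinuousMap.coe_mk, map_mul, Complex.conj_ofReal, map_prod,
      sub_eq_add_neg, fourier_add, Finset.prod_mul_distrib, fourier_neg]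
    ring
  simp only [hx]
  rw [integral_const_mul, integral_fintype_prod_volume_eq_prod
    (fun l (y : AddCircle (2 * Real.pi)) => (fourier (k l - j l) y : ℂ)),
    Finset.prod_eq_zero (Finset.mem_univ i)
      (integral_fourier_eq_zero (sub_ne_zero.2 (Ne.symm hi))), mul_zero]

theorem conj_eigenfunction {d : ℕ} (k : Fin d → ℤ) (x : Torus d) :
    conj (eigenfunction k x) = eigenfunction (-k) x := by
  simp [eigenfunction]

/-- The real function `Re (a φ_k)`. -/
def mode {d : ℕ} (k : Fin d → ℤ) (a : ℂ) : C(Torus d, ℝ) where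
  toFun x := (a * eigenfunction k x).re
  continuous_toFun :=
    Complex.continuous_re.comp (continuous_const.mul (eigenfunction k).continuous)

/-- The real function `Re (a φ_k)`, as an element of `L²`. -/
def modeL2 {d : ℕ} (k : Fin d → ℤ) (a : ℂ) : L2 d :=
  ContinuousMap.toLp (E := ℝ) 2 volume ℝ (mode k a)

theorem coeff_modeL2_eq_zero {d : ℕ} {j k : Fin d → ℤ} (a : ℂ) (h1 : j ≠ k) (h2 : j ≠ -k) :
    coeff (modeL2 k a) j = 0 := by
  have h : coeff (modeL2 k a) j = ∫ x : Torus d,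
      ((a / 2) * (conj (eigenfunction j x) * eigenfunction k x) +
        (conj a / 2) * (conj (eigenfunction j x) * eigenfunction (-k) x)) := by
    apply integral_congr_ae
    filter_upwards [ContinuousMap.coeFn_toLp (p := 2) (E := ℝ) (𝕜 := ℝ)
      (volume : Measure (Torus d)) (mode k a)] with x hx
    have hr : ((mode k a x : ℝ) : ℂ) =
        (a * eigenfunction k x + conj (a * eigenfunction k x)) / 2 := Complex.re_eq_add_conj _
    rw [modeL2, hx, hr, map_mul, conj_eigenfunction k]
    ring
  have hc : ∀ m : Fin d → ℤ, Integrable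
      (fun x : Torus d => conj (eigenfunction j x) * eigenfunction m x) := fun m =>
    Continuous.integrable_of_hasCompactSupport
      ((Complex.continuous_conj.comp (eigenfunction j).continuous).mul (eigenfunction m).continuous)
      (HasCompactSupport.of_compactSpace _)
  rw [h, integral_add ((hc k).const_mul _) ((hc (-k)).const_mul _), integral_const_mul,
    integral_const_mul, integral_conj_eigenfunction_mul h1, integral_conj_eigenfunction_mul h2]
  simp

/-- The real function `Re (a φ_k)`, as an element of `H¹`. -/
def modeH1 {d : ℕ} (k : Fin d → ℤ) (a : ℂ) : H1 d :=
  ⟨modeL2 k a, summable_of_ne_finset_zero (s := {k, -k}) fun j hj => by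
    simp only [Finset.mem_insert, Finset.mem_singleton, not_or] at hj
    simp [coeff_modeL2_eq_zero a hj.1 hj.2]⟩

/-- The Fourier coefficient at `k` of the profile of `e^{t𝒜} W`. -/
def profileCoeff {d : ℕ} (t : ℝ) (W : State d) (k : Fin d → ℤ) : ℂ :=
  (Real.cos (freq k * t) : ℂ) * coeff W.fst.toL2 k +
    ((if k = 0 then t else Real.sin (freq k * t) / freq k : ℝ) : ℂ) * coeff W.snd k

/-- The Fourier coefficient at `k` of the velocity of `e^{t𝒜} W`. -/
def velocityCoeff {d : ℕ} (t : ℝ) (W : State d) (k : Fin d → ℤ) : ℂ :=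
  ((-(freq k * Real.sin (freq k * t)) : ℝ) : ℂ) * coeff W.fst.toL2 k +
    (Real.cos (freq k * t) : ℂ) * coeff W.snd k

/-- The free evolution `e^{t𝒜}`, `𝒜 = (0, I; Δ, 0)`, through its Fourier series, which converges
in `H¹ × L²`. The sum of the series `∑_k a_k φ_k` of a real function is real, so that each term
may be replaced by its real part. -/
def freeEvolution {d : ℕ} (t : ℝ) (W : State d) : State d :=
  ∑' k : Fin d → ℤ, mkState (modeH1 k (profileCoeff t W k)) (modeL2 k (velocityCoeff t W k))

/-- Indices of the `2d + 1` controls: the constant, the `d` cosines and the `d` sines. -/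
abbrev ControlIndex (d : ℕ) : Type := Unit ⊕ Fin d ⊕ Fin d

/-- The functions `1`, `cos x_i`, `sin x_i` on the torus. -/
def lowMode {d : ℕ} : ControlIndex d → C(Torus d, ℝ)
  | .inl _ => 1
  | .inr (.inl i) => ⟨fun x => (fourier 1 (x i) : ℂ).re, by fun_prop⟩
  | .inr (.inr i) => ⟨fun x => (fourier 1 (x i) : ℂ).im, by fun_prop⟩

theorem fourier_one_coe (y : ℝ) :
    (fourier 1 (y : AddCircle (2 * Real.pi)) : ℂ) = Complex.exp (y * Complex.I) := by
  rw [fourier_coe_apply]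
  congr 1
  have : (Real.pi : ℂ) ≠ 0 := by exact_mod_cast Real.pi_ne_zero
  push_cast
  field_simp

theorem lowMode_cos {d : ℕ} (i : Fin d) (y : Fin d → ℝ) :
    lowMode (.inr (.inl i)) (fun l => (y l : AddCircle (2 * Real.pi))) = Real.cos (y i) := by
  simp only [lowMode, ContinuousMap.coe_mk, fourier_one_coe, Complex.exp_ofReal_mul_I_re]

theorem lowMode_sin {d : ℕ} (i : Fin d) (y : Fin d → ℝ) :
    lowMode (.inr (.inr i)) (fun l => (y l : AddCircle (2 * Real.pi))) = Real.sin (y i) := by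
  simp only [lowMode, ContinuousMap.coe_mk, fourier_one_coe, Complex.exp_ofReal_mul_I_im]

/-- The control function `μ(x) = ∑_j p_j μ_j(x)` at a fixed time. -/
def controlFunction {d : ℕ} (p : ControlIndex d → ℝ) : C(Torus d, ℝ) := ∑ j, p j • lowMode j

/-- The product of a continuous function and an `L²` function, in `L²`. -/
def mulL2 {d : ℕ} (g : C(Torus d, ℝ)) (w : L2 d) : L2 d :=
  MemLp.toLp (fun x => g x * w x)
    ((Lp.memLp w).mul' (p := ∞) (r := 2) (ContinuousMap.memLp _ ℝ g))

/-- The operator `∑_j p_j μ_j ℬ`, `ℬ = (0, 0; I, 0)`: it maps `(w, v)` to `(0, ∑_j p_j μ_j w)`. -/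
def controlOperator {d : ℕ} (p : ControlIndex d → ℝ) (W : State d) : State d :=
  mkState 0 (mulL2 (controlFunction p) W.fst.toL2)

/-- `p` is piecewise constant on `[0, τ]`: there are `0 = t_0 ≤ t_1 ≤ ⋯ ≤ t_n = τ` such that `p`
is constant on each interval `(t_i, t_{i+1})`. -/
def IsPiecewiseConstant {E : Type*} (τ : ℝ) (p : ℝ → E) : Prop :=
  ∃ (n : ℕ) (t : ℕ → ℝ), Monotone t ∧ t 0 = 0 ∧ t n = τ ∧
    ∀ i < n, ∃ c, ∀ s ∈ Ioo (t i) (t (i + 1)), p s = c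

/-- `W` is the weak (mild) solution on `[0, τ]` of `∂_t W = (𝒜 + ∑_j p_j(t) μ_j ℬ) W` with
`W(0) = W₀`, that is, of `∂_t² w = (Δ + ∑_j p_j(t) μ_j) w` with `(w, ∂_t w)(0) = W₀`. -/
def IsSolution {d : ℕ} (τ : ℝ) (p : ℝ → ControlIndex d → ℝ) (W₀ : State d) (W : ℝ → State d) :
    Prop :=
  ContinuousOn W (Icc 0 τ) ∧ ∀ t ∈ Icc 0 τ,
    W t = freeEvolution t W₀ +
      ∫ s in (0 : ℝ)..t, freeEvolution (t - s) (controlOperator (p s) (W s))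

end TorusWave

end

/-!
A control `τ⁻¹ q` acting during a short time `τ` approximates the kick `(w, v) ↦ (w, v + f w)` with
`f = ∑ⱼ qⱼ μⱼ`. If `f` multiplies `H¹` into itself, then conjugating the free evolution over time
`t` by the kicks with potentials `± t ^ (-1/2) f` and letting `t → 0` yields the kick by `-f²`.
Hence the functions all of whose multiples are potentials of approximable kicks form a linear space
containing the `μⱼ`, and the kick by `-c f²` is approximable for each `f` in it and `c ≥ 0`. As
`cos² + sin² = 1` and constants are available, the space contains the squares themselves, then by
polarization the products, and so all trigonometric polynomials. By density every continuous
function is the potential of an approximable kick.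

Finally `w₀ φ` is in the `L²`-closure of the functions `g w₀` with `g` continuous: if `v` is
orthogonal to all of them, then `w₀ v = 0` almost everywhere, and so `⟪w₀ φ, v⟫ = 0`. For `d ≤ 1`
the Fourier series of `w₀ ∈ H¹` converges absolutely, so `w₀` is bounded and `w₀ φ ∈ L²`.
-/

noncomputable section

namespace TorusWave

open Filter Topology

/-! ### Piecewise constant functions -/

section PiecewiseConstant

variable {E F : Type*} {τ : ℝ} {p : ℝ → E}

theorem isPiecewiseConstant_const (hτ : 0 ≤ τ) (c : E) : IsPiecewiseConstant τ fun _ => c := by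
  refine ⟨1, fun i => if i = 0 then 0 else τ, ?_, by simp, by simp, fun i _ => ⟨c, fun _ _ => rfl⟩⟩
  intro i j hij
  beta_reduce
  split_ifs <;> first | omega | exact hτ | exact le_rfl

theorem IsPiecewiseConstant.comp (hp : IsPiecewiseConstant τ p) (g : E → F) :
    IsPiecewiseConstant τ fun s => g (p s) := by
  obtain ⟨n, t, ht, h₀, hn, hc⟩ := hp
  refine ⟨n, t, ht, h₀, hn, fun i hi => ?_⟩
  obtain ⟨c, hc⟩ := hc i hi
  exact ⟨g c, fun s hs => congrArg g (hc s hs)⟩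

theorem IsPiecewiseConstant.concat {τ₁ τ₂ : ℝ} {p₁ p₂ : ℝ → E} (h₁ : IsPiecewiseConstant τ₁ p₁)
    (h₂ : IsPiecewiseConstant τ₂ p₂) :
    IsPiecewiseConstant (τ₁ + τ₂) fun s => if s < τ₁ then p₁ s else p₂ (s - τ₁) := by
  obtain ⟨n, t, ht, ht₀, htn, hc₁⟩ := h₁
  obtain ⟨m, u, hu, hu₀, hum, hc₂⟩ := h₂
  have hmono : Monotone fun i => t (min i n) + u (i - n) :=
    (ht.comp fun i j hij => min_le_min_right n hij).add
      (hu.comp fun i j hij => Nat.sub_le_sub_right hij n)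
  refine ⟨n + m, fun i => t (min i n) + u (i - n), hmono, by simp [ht₀, hu₀], by simp [htn, hum],
    fun i hi => ?_⟩
  rcases lt_or_ge i n with hin | hin
  · obtain ⟨c, hc⟩ := hc₁ i hin
    refine ⟨c, fun s hs => ?_⟩
    simp only [min_eq_left hin.le, min_eq_left (Nat.succ_le_of_lt hin),
      Nat.sub_eq_zero_of_le hin.le, Nat.sub_eq_zero_of_le (Nat.succ_le_of_lt hin), hu₀,
      add_zero] at hs
    have hsτ : s < τ₁ := hs.2.trans_le (htn ▸ ht (Nat.succ_le_of_lt hin))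
    exact (if_pos hsτ).trans (hc s hs)
  · obtain ⟨c, hc⟩ := hc₂ (i - n) (by omega)
    refine ⟨c, fun s hs => ?_⟩
    simp only [min_eq_right hin, min_eq_right (hin.trans i.le_succ), htn,
      Nat.sub_add_comm hin] at hs
    have hu_nonneg : 0 ≤ u (i - n) := hu₀ ▸ hu (Nat.zero_le _)
    have hsτ : ¬ s < τ₁ := by linarith [hs.1]
    exact (if_neg hsτ).trans (hc _ ⟨by linarith [hs.1], by linarith [hs.2]⟩)

theorem IsPiecewiseConstant.finite_image_Icc (hp : IsPiecewiseConstant τ p) :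
    (p '' Icc 0 τ).Finite := by
  obtain ⟨n, t, -, h₀, hn, hc⟩ := hp
  suffices H : ∀ j ≤ n, (p '' Icc 0 (t j)).Finite from hn ▸ H n le_rfl
  intro j hj
  induction j with
  | zero => simp [h₀]
  | succ j ih =>
    obtain ⟨c, hc⟩ := hc j hj
    refine ((ih (Nat.le_of_succ_le hj)).union (toFinite {c, p (t (j + 1))})).subset ?_
    rintro _ ⟨s, hs, rfl⟩
    rcases le_or_gt s (t j) with hsj | hsj
    · exact .inl ⟨s, ⟨hs.1, hsj⟩, rfl⟩
    · rcases hs.2.lt_or_eq with hsj' | rfl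
      · exact .inr (.inl (hc s ⟨hsj, hsj'⟩))
      · exact .inr (.inr rfl)

theorem IsPiecewiseConstant.exists_norm_le [SeminormedAddCommGroup E]
    (hp : IsPiecewiseConstant τ p) : ∃ N, ∀ s ∈ Icc 0 τ, ‖p s‖ ≤ N := by
  obtain ⟨N, hN⟩ := hp.finite_image_Icc.isBounded.exists_norm_le
  exact ⟨N, fun s hs => hN _ (mem_image_of_mem p hs)⟩

theorem IsPiecewiseConstant.intervalIntegrable [NormedAddCommGroup F]
    (hp : IsPiecewiseConstant τ p) {g : E → ℝ → F} (hg : ∀ c, ContinuousOn (g c) (Icc 0 τ)) :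
    IntervalIntegrable (fun s => g (p s) s) volume 0 τ := by
  obtain ⟨n, t, ht, h₀, rfl, hc⟩ := hp
  rw [← h₀] at hg ⊢
  refine IntervalIntegrable.trans_iterate fun i hi => ?_
  obtain ⟨c, hc⟩ := hc i hi
  have hle : t i ≤ t (i + 1) := ht i.le_succ
  have hsub : Icc (t i) (t (i + 1)) ⊆ Icc (t 0) (t n) := Icc_subset_Icc (ht i.zero_le) (ht hi)
  have hgi := ((hg c).mono hsub).intervalIntegrable_of_Icc (μ := volume) hle
  rw [intervalIntegrable_iff_integrableOn_Ioo_of_le hle] at hgi ⊢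
  exact hgi.congr_fun (fun s hs => by rw [hc s hs]) measurableSet_Ioo

end PiecewiseConstant

/-! ### Mild solutions of bounded perturbations of a strongly continuous group -/

theorem le_mul_exp_of_le_add_integral {u : ℝ → ℝ} {τ a K : ℝ} (hu : ContinuousOn u (Icc 0 τ))
    (hu₀ : ∀ t ∈ Icc 0 τ, 0 ≤ u t) (hK : 0 ≤ K)
    (h : ∀ t ∈ Icc 0 τ, u t ≤ a + K * ∫ s in (0 : ℝ)..t, u s) {t : ℝ} (ht : t ∈ Icc 0 τ) :
    u t ≤ a * Real.exp (K * t) := by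
  have hτ : 0 ≤ τ := ht.1.trans ht.2
  have hint : ∀ t ∈ Icc 0 τ, IntervalIntegrable u volume 0 t := fun t ht =>
    (hu.mono (Icc_subset_Icc_right ht.2)).intervalIntegrable_of_Icc ht.1
  have hderiv : ∀ t ∈ Ico 0 τ,
      HasDerivWithinAt (fun t => ∫ s in (0 : ℝ)..t, u s) (u t) (Ici t) t := by
    intro t ht
    have hle : 𝓝[>] t ≤ 𝓝[Icc 0 τ] t := nhdsWithin_le_of_mem <|
      mem_of_superset (Ioc_mem_nhdsGT ht.2) fun s hs => ⟨ht.1.trans hs.1.le, hs.2⟩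
    exact intervalIntegral.integral_hasDerivWithinAt_right (hint t ⟨ht.1, ht.2.le⟩)
      ((hu.stronglyMeasurableAtFilter_nhdsWithin measurableSet_Icc t).filter_mono hle)
      ((hu t ⟨ht.1, ht.2.le⟩).mono_left hle)
  have hcont : ContinuousOn (fun t => ∫ s in (0 : ℝ)..t, u s) (Icc 0 τ) := by
    simpa only [uIcc_of_le hτ] using
      intervalIntegral.continuousOn_primitive_interval' (hint τ ⟨hτ, le_rfl⟩) left_mem_uIcc
  have hnorm : ∀ t ∈ Icc 0 τ, ‖∫ s in (0 : ℝ)..t, u s‖ = ∫ s in (0 : ℝ)..t, u s := fun t ht =>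
    Real.norm_of_nonneg <| intervalIntegral.integral_nonneg ht.1 fun s hs =>
      hu₀ s ⟨hs.1, hs.2.trans ht.2⟩
  have hbound : ∫ s in (0 : ℝ)..t, u s ≤ gronwallBound 0 K a t := by
    have := norm_le_gronwallBound_of_norm_deriv_right_le (δ := 0) (K := K) (ε := a) hcont hderiv
      (by simp) (fun t ht => by
        have ht' : t ∈ Icc 0 τ := ⟨ht.1, ht.2.le⟩
        rw [hnorm t ht', Real.norm_of_nonneg (hu₀ t ht'), add_comm]
        exact h t ht') t ht
    rwa [hnorm t ht, sub_zero] at this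
  calc u t ≤ a + K * gronwallBound 0 K a t := (h t ht).trans (by gcongr)
    _ = a * Real.exp (K * t) := by
      rcases eq_or_ne K 0 with rfl | hK0
      · simp
      · rw [gronwallBound_of_K_ne_0 hK0]
        field_simp
        ring

/-- A strongly continuous one-parameter group `t ↦ S t` of bounded operators. -/
structure C0Group (X : Type*) [NormedAddCommGroup X] [NormedSpace ℝ X] where
  op : ℝ → X →L[ℝ] X
  op_zero : op 0 = 1
  op_add : ∀ s t, op (s + t) = op s * op t
  continuous_op_apply : ∀ x, Continuous fun t => op t x

theorem ite_le_eq_of_ge {E : Type*} {W V : ℝ → E} {τ₁ t : ℝ} (hVW : V 0 = W τ₁) (ht : τ₁ ≤ t) :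
    (if t ≤ τ₁ then W t else V (t - τ₁)) = V (t - τ₁) := by
  rcases ht.eq_or_lt with rfl | h
  · rw [if_pos le_rfl, sub_self, hVW]
  · exact if_neg h.not_ge

theorem continuousOn_concat {E : Type*} [TopologicalSpace E] {W V : ℝ → E} {τ₁ τ₂ : ℝ}
    (hτ₁ : 0 ≤ τ₁) (hτ₂ : 0 ≤ τ₂) (hW : ContinuousOn W (Icc 0 τ₁))
    (hV : ContinuousOn V (Icc 0 τ₂)) (hVW : V 0 = W τ₁) :
    ContinuousOn (fun t => if t ≤ τ₁ then W t else V (t - τ₁)) (Icc 0 (τ₁ + τ₂)) := by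
  rw [← Icc_union_Icc_eq_Icc hτ₁ (le_add_of_nonneg_right hτ₂)]
  refine ContinuousOn.union_of_isClosed ?_ ?_ isClosed_Icc isClosed_Icc
  · exact hW.congr fun t ht => if_pos ht.2
  · refine (hV.comp (continuousOn_id.sub continuousOn_const) fun t ht => ?_).congr
      fun t ht => ite_le_eq_of_ge hVW ht.1
    exact ⟨by simpa using ht.1, by simpa [add_comm] using ht.2⟩

section MildSolutions

variable {X : Type*} [NormedAddCommGroup X] [NormedSpace ℝ X]

instance : CoeFun (C0Group X) fun _ => ℝ → X →L[ℝ] X := ⟨C0Group.op⟩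

/-- `W` is the mild solution on `[0, τ]` of `W' = (A + C(t)) W`, `W(0) = x`, where `A` is the
generator of the group `S`. -/
def IsMild (S : C0Group X) (τ : ℝ) (C : ℝ → X →L[ℝ] X) (x : X) (W : ℝ → X) : Prop :=
  ContinuousOn W (Icc 0 τ) ∧ ∀ t ∈ Icc 0 τ,
    W t = S t x + ∫ s in (0 : ℝ)..t, S (t - s) (C s (W s))

variable {S : C0Group X} {τ : ℝ} {C : ℝ → X →L[ℝ] X} {x y : X} {W V : ℝ → X}

theorem C0Group.op_add_apply (S : C0Group X) (s t : ℝ) (x : X) : S (s + t) x = S s (S t x) := by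
  rw [S.op_add, mul_apply_eq_comp]

theorem IsMild.apply_zero (hW : IsMild S τ C x W) (hτ : 0 ≤ τ) : W 0 = x := by
  rw [hW.2 0 ⟨le_rfl, hτ⟩, intervalIntegral.integral_same, add_zero, S.op_zero,
    one_apply_eq_self]

theorem isMild_zero (S : C0Group X) (τ : ℝ) (x : X) : IsMild S τ 0 x fun t => S t x :=
  ⟨(S.continuous_op_apply x).continuousOn, by simp⟩

theorem IsMild.sub_integral (hW : IsMild S τ C x W) {t : ℝ} (ht : t ∈ Icc 0 τ) :
    W t - ∫ s in (0 : ℝ)..t, S (t - s) (C s (W s)) = S t x := by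
  rw [sub_eq_iff_eq_add, ← hW.2 t ht]

theorem integral_concat_of_le (S : C0Group X) {C₁ C₂ : ℝ → X →L[ℝ] X} (r : ℝ) {τ₁ t : ℝ}
    (ht : t ∈ Icc 0 τ₁) :
    ∫ s in (0 : ℝ)..t, S (r - s)
      ((if s < τ₁ then C₁ s else C₂ (s - τ₁)) (if s ≤ τ₁ then W s else V (s - τ₁))) =
    ∫ s in (0 : ℝ)..t, S (r - s) (C₁ s (W s)) := by
  refine intervalIntegral.integral_congr_ae ?_
  filter_upwards [Measure.ae_ne volume τ₁] with s hs hst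
  rw [uIoc_of_le ht.1] at hst
  have hsτ : s < τ₁ := lt_of_le_of_ne (hst.2.trans ht.2) hs
  rw [if_pos hsτ, if_pos hsτ.le]

theorem integral_concat_of_ge (S : C0Group X) {C₁ C₂ : ℝ → X →L[ℝ] X} {τ₁ t : ℝ}
    (hVW : V 0 = W τ₁) (ht : τ₁ ≤ t) :
    ∫ s in τ₁..t, S (t - s)
      ((if s < τ₁ then C₁ s else C₂ (s - τ₁)) (if s ≤ τ₁ then W s else V (s - τ₁))) =
    ∫ s in (0 : ℝ)..(t - τ₁), S (t - τ₁ - s) (C₂ s (V s)) := by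
  rw [← sub_self τ₁, ← intervalIntegral.integral_comp_sub_right
    (fun s => S (t - τ₁ - s) (C₂ s (V s))) τ₁]
  refine intervalIntegral.integral_congr fun s hs => ?_
  rw [uIcc_of_le ht] at hs
  rw [ite_le_eq_of_ge hVW hs.1, if_neg (not_lt.2 hs.1), sub_sub_sub_cancel_right]

variable [CompleteSpace X]

theorem C0Group.exists_norm_le (S : C0Group X) (T : ℝ) : ∃ M, ∀ t, |t| ≤ T → ‖S t‖ ≤ M := by
  obtain ⟨M, hM⟩ := banach_steinhaus (g := fun t : Icc (-T) T => S t) fun x => by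
    obtain ⟨R, hR⟩ := (isCompact_Icc (a := -T) (b := T)).exists_bound_of_continuousOn
      (S.continuous_op_apply x).continuousOn
    exact ⟨R, fun t => hR t t.2⟩
  exact ⟨M, fun t ht => hM ⟨t, abs_le.1 ht⟩⟩

theorem C0Group.continuous_uncurry (S : C0Group X) :
    Continuous fun q : ℝ × X => S q.1 q.2 := by
  refine continuous_iff_continuousAt.2 fun ⟨t, x⟩ => ?_
  obtain ⟨M, hM⟩ := S.exists_norm_le (|t| + 1)
  have hlip : ∀ s ∈ Icc (t - 1) (t + 1), LipschitzOnWith M.toNNReal (fun x => S s x) univ := by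
    intro s hs
    have hst : |s - t| ≤ 1 := abs_le.2 ⟨by linarith [hs.1], by linarith [hs.2]⟩
    have hs' : |s| ≤ |t| + 1 := by linarith [abs_sub_abs_le_abs_sub s t]
    refine (AddMonoidHomClass.lipschitz_of_bound _ M fun x => ?_).lipschitzOnWith
    exact (S s).le_of_opNorm_le (hM s hs') x
  refine (continuousOn_prod_of_continuousOn_lipschitzOnWith' _ M.toNNReal hlip
    fun x _ => (S.continuous_op_apply x).continuousOn).continuousAt ?_
  exact prod_mem_nhds (Icc_mem_nhds (by linarith) (by linarith)) univ_mem

theorem C0Group.continuousOn_op_sub_apply (S : C0Group X) (r : ℝ) {f : ℝ → X} {s : Set ℝ}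
    (hf : ContinuousOn f s) : ContinuousOn (fun t => S (r - t) (f t)) s :=
  S.continuous_uncurry.comp_continuousOn ((continuousOn_const.sub continuousOn_id).prodMk hf)

theorem C0Group.intervalIntegrable (S : C0Group X) (hC : IsPiecewiseConstant τ C)
    (hW : ContinuousOn W (Icc 0 τ)) (r : ℝ) {a b : ℝ} (ha : a ∈ Icc 0 τ) (hb : b ∈ Icc 0 τ) :
    IntervalIntegrable (fun s => S (r - s) (C s (W s))) volume a b := by
  refine (hC.intervalIntegrable (g := fun c s => S (r - s) (c (W s))) fun c =>
    S.continuousOn_op_sub_apply r (c.continuous.comp_continuousOn hW)).mono_set ?_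
  rw [uIcc_of_le (ha.1.trans ha.2)]
  exact uIcc_subset_Icc ha hb

/-- Comparison of two approximate mild solutions: `δ` bounds the difference of their defects. -/
theorem norm_sub_le_mul_exp {M N δ : ℝ} (hC : IsPiecewiseConstant τ C)
    (hW : ContinuousOn W (Icc 0 τ)) (hV : ContinuousOn V (Icc 0 τ))
    (hM : ∀ t ∈ Icc 0 τ, ‖S t‖ ≤ M) (hN : ∀ t ∈ Icc 0 τ, ‖C t‖ ≤ N)
    (hδ : ∀ t ∈ Icc 0 τ, ‖(W t - ∫ s in (0 : ℝ)..t, S (t - s) (C s (W s))) -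
      (V t - ∫ s in (0 : ℝ)..t, S (t - s) (C s (V s)))‖ ≤ δ) {t : ℝ} (ht : t ∈ Icc 0 τ) :
    ‖W t - V t‖ ≤ δ * Real.exp (M * N * t) := by
  have hτ : 0 ≤ τ := ht.1.trans ht.2
  have hM₀ : 0 ≤ M := (norm_nonneg _).trans (hM t ht)
  have hN₀ : 0 ≤ N := (norm_nonneg _).trans (hN t ht)
  have hcont : ContinuousOn (fun t => ‖W t - V t‖) (Icc 0 τ) := (hW.sub hV).norm
  refine le_mul_exp_of_le_add_integral hcont (fun _ _ => norm_nonneg _) (by positivity)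
    (fun t ht => ?_) ht
  have hsub : Icc 0 t ⊆ Icc 0 τ := Icc_subset_Icc_right ht.2
  have hintegral : ‖∫ s in (0 : ℝ)..t, (S (t - s) (C s (W s)) - S (t - s) (C s (V s)))‖ ≤
      ∫ s in (0 : ℝ)..t, M * N * ‖W s - V s‖ := by
    refine intervalIntegral.norm_integral_le_of_norm_le ht.1 (ae_of_all _ fun s hs => ?_)
      (((hcont.mono hsub).const_mul _).intervalIntegrable_of_Icc ht.1)
    rw [← map_sub, ← map_sub, mul_assoc]
    exact (S (t - s)).le_of_opNorm_le_of_le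
      (hM _ ⟨by linarith [hs.2], by linarith [hs.1, ht.2]⟩)
      ((C s).le_of_opNorm_le (hN s (hsub ⟨hs.1.le, hs.2⟩)) _)
  have h₀ : (0 : ℝ) ∈ Icc 0 τ := ⟨le_rfl, hτ⟩
  rw [intervalIntegral.integral_sub (S.intervalIntegrable hC hW t h₀ ht)
    (S.intervalIntegrable hC hV t h₀ ht), intervalIntegral.integral_const_mul] at hintegral
  calc ‖W t - V t‖ = ‖_ + _‖ := by rw [sub_sub_sub_comm, sub_add_cancel]
    _ ≤ δ + M * N * ∫ s in (0 : ℝ)..t, ‖W s - V s‖ :=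
      norm_add_le_of_le (hδ t ht) hintegral

theorem exists_norm_sub_le (S : C0Group X) (hτ : 0 ≤ τ) (hC : IsPiecewiseConstant τ C) :
    ∃ L, ∀ x y W V, IsMild S τ C x W → IsMild S τ C y V → ‖W τ - V τ‖ ≤ L * ‖x - y‖ := by
  obtain ⟨M, hM⟩ := S.exists_norm_le τ
  obtain ⟨N, hN⟩ := hC.exists_norm_le
  have hM' : ∀ t ∈ Icc 0 τ, ‖S t‖ ≤ M := fun t ht => hM t (by rw [abs_of_nonneg ht.1]; exact ht.2)
  refine ⟨M * Real.exp (M * N * τ), fun x y W V hW hV => ?_⟩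
  refine (norm_sub_le_mul_exp hC hW.1 hV.1 hM' hN (δ := M * ‖x - y‖) (fun t ht => ?_)
    (right_mem_Icc.2 hτ)).trans_eq (by ring)
  rw [hW.sub_integral ht, hV.sub_integral ht, ← map_sub]
  exact (S t).le_of_opNorm_le (hM' t ht) _

theorem IsMild.unique (hW : IsMild S τ C x W) (hV : IsMild S τ C x V) (hτ : 0 ≤ τ)
    (hC : IsPiecewiseConstant τ C) : W τ = V τ := by
  obtain ⟨L, hL⟩ := exists_norm_sub_le S hτ hC
  simpa [sub_eq_zero] using hL x x W V hW hV

theorem IsMild.concat {τ₁ τ₂ : ℝ} {C₁ C₂ : ℝ → X →L[ℝ] X} (hτ₁ : 0 ≤ τ₁) (hτ₂ : 0 ≤ τ₂)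
    (hC₁ : IsPiecewiseConstant τ₁ C₁) (hC₂ : IsPiecewiseConstant τ₂ C₂)
    (hW : IsMild S τ₁ C₁ x W) (hV : IsMild S τ₂ C₂ (W τ₁) V) :
    IsMild S (τ₁ + τ₂) (fun s => if s < τ₁ then C₁ s else C₂ (s - τ₁)) x
      (fun t => if t ≤ τ₁ then W t else V (t - τ₁)) := by
  have hVW : V 0 = W τ₁ := hV.apply_zero hτ₂
  have hcont := continuousOn_concat hτ₁ hτ₂ hW.1 hV.1 hVW
  refine ⟨hcont, fun t ht => ?_⟩
  beta_reduce
  rcases le_total t τ₁ with h | h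
  · rw [if_pos h, integral_concat_of_le S t ⟨ht.1, h⟩]
    exact hW.2 t ⟨ht.1, h⟩
  have h₀ : (0 : ℝ) ∈ Icc 0 (τ₁ + τ₂) := ⟨le_rfl, by linarith⟩
  have h₁ : τ₁ ∈ Icc 0 (τ₁ + τ₂) := ⟨hτ₁, by linarith⟩
  have h₁' : τ₁ ∈ Icc 0 τ₁ := right_mem_Icc.2 hτ₁
  have hprop : S (t - τ₁) (W τ₁) = S t x + ∫ s in (0 : ℝ)..τ₁, S (t - s) (C₁ s (W s)) := by
    rw [hW.2 τ₁ h₁', map_add, ← S.op_add_apply, sub_add_cancel,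
      ← ContinuousLinearMap.intervalIntegral_comp_comm _
        (S.intervalIntegrable hC₁ hW.1 τ₁ (left_mem_Icc.2 hτ₁) h₁')]
    simp only [← S.op_add_apply, sub_add_sub_cancel]
  have hC := hC₁.concat hC₂
  rw [ite_le_eq_of_ge hVW h, hV.2 _ ⟨by linarith, by linarith [ht.2]⟩, hprop, add_assoc,
    ← intervalIntegral.integral_add_adjacent_intervals
      (S.intervalIntegrable hC hcont t h₀ h₁) (S.intervalIntegrable hC hcont t h₁ ht),
    integral_concat_of_le S t h₁', integral_concat_of_ge S hVW h]

section ConstantPerturbation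

variable (S : C0Group X) (B : X →L[ℝ] X) (x : X)

/-- The right-hand side of the mild equation with constant perturbation `B`, as a map of
`C([0, τ], X)`: its fixed points are the mild solutions. -/
def duhamel (hτ : 0 ≤ τ) (w : C(Icc 0 τ, X)) : C(Icc 0 τ, X) where
  toFun t := S t x + ∫ s in (0 : ℝ)..t, S (t - s) (B (IccExtend hτ w s))
  continuous_toFun := by
    have hint : Continuous (Function.uncurry fun t s => S (t - s) (B (IccExtend hτ w s))) :=
      S.continuous_uncurry.comp ((continuous_fst.sub continuous_snd).prodMk
        (B.continuous.comp (w.continuous.Icc_extend'.comp continuous_snd)))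
    exact ((S.continuous_op_apply x).add
      (intervalIntegral.continuous_parametric_intervalIntegral_of_continuous hint
        continuous_id)).comp continuous_subtype_val

variable {S B}

theorem contractingWith_duhamel (hτ : 0 ≤ τ) {M : ℝ} (hM : ∀ t, |t| ≤ τ → ‖S t‖ ≤ M)
    (hB : M * ‖B‖ * τ ≤ 1 / 2) : ContractingWith (1 / 2) (duhamel S B x hτ) := by
  have hM₀ : 0 ≤ M := (norm_nonneg _).trans (hM 0 (by simpa using hτ))
  refine ⟨by norm_num, LipschitzWith.of_dist_le_mul fun w v => ?_⟩
  refine (ContinuousMap.dist_le (by positivity)).2 fun t => ?_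
  have hint : ∀ w : C(Icc 0 τ, X),
      IntervalIntegrable (fun s => S (t - s) (B (IccExtend hτ w s))) volume 0 t := fun w =>
    S.intervalIntegrable (isPiecewiseConstant_const hτ B) w.continuous.Icc_extend'.continuousOn t
      (left_mem_Icc.2 hτ) t.2
  have hbound : ∀ s ∈ uIoc (0 : ℝ) t, ‖S (t - s) (B (IccExtend hτ w s)) -
      S (t - s) (B (IccExtend hτ v s))‖ ≤ M * (‖B‖ * dist w v) := by
    intro s hs
    rw [uIoc_of_le t.2.1] at hs
    rw [← map_sub, ← map_sub]
    refine (S (t - s)).le_of_opNorm_le_of_le (hM _ ?_) (B.le_of_opNorm_le_of_le le_rfl ?_)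
    · rw [abs_of_nonneg (by linarith [hs.2])]
      linarith [hs.1, t.2.2]
    · rw [← dist_eq_norm]
      exact ContinuousMap.dist_apply_le_dist _
  calc dist (duhamel S B x hτ w t) (duhamel S B x hτ v t)
      = ‖∫ s in (0 : ℝ)..t, (S (t - s) (B (IccExtend hτ w s)) -
          S (t - s) (B (IccExtend hτ v s)))‖ := by
        rw [intervalIntegral.integral_sub (hint w) (hint v), dist_eq_norm]
        exact congrArg norm (add_sub_add_left_eq_sub _ _ _)
    _ ≤ M * (‖B‖ * dist w v) * |(t : ℝ) - 0| :=
        intervalIntegral.norm_integral_le_of_norm_le_const hbound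
    _ ≤ M * (‖B‖ * dist w v) * τ := by
        rw [sub_zero, abs_of_nonneg t.2.1]
        gcongr
        exact t.2.2
    _ = M * ‖B‖ * τ * dist w v := by ring
    _ ≤ 1 / 2 * dist w v := by gcongr
    _ = _ := by simp

theorem exists_isMild_const_of_norm_le (hτ : 0 ≤ τ) {M : ℝ} (hM : ∀ t, |t| ≤ τ → ‖S t‖ ≤ M)
    (hB : M * ‖B‖ * τ ≤ 1 / 2) : ∃ W, IsMild S τ (fun _ => B) x W := by
  have hT := contractingWith_duhamel x hτ hM hB
  set w := ContractingWith.fixedPoint _ hT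
  have hw : duhamel S B x hτ w = w := hT.fixedPoint_isFixedPt
  refine ⟨IccExtend hτ w, w.continuous.Icc_extend'.continuousOn, fun t ht => ?_⟩
  rw [IccExtend_of_mem hτ _ ht]
  exact (DFunLike.congr_fun hw ⟨t, ht⟩).symm

theorem exists_isMild_const (S : C0Group X) (B : X →L[ℝ] X) (hτ : 0 ≤ τ) (x : X) :
    ∃ W, IsMild S τ (fun _ => B) x W := by
  obtain ⟨M, hM⟩ := S.exists_norm_le τ
  obtain ⟨n, hn⟩ := exists_nat_ge (2 * (M * ‖B‖ * τ))
  have hδ : 0 ≤ τ / (n + 1) := by positivity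
  have hδτ : τ / (n + 1) ≤ τ := div_le_self hτ (by linarith [n.cast_nonneg (α := ℝ)])
  have hsmall : M * ‖B‖ * (τ / (n + 1)) ≤ 1 / 2 := by
    rw [← mul_div_assoc, div_le_iff₀ (by positivity)]
    linarith
  suffices H : ∀ (k : ℕ) (x : X), ∃ W, IsMild S (k * (τ / (n + 1))) (fun _ => B) x W by
    have := H (n + 1) x
    rwa [Nat.cast_add_one, mul_div_cancel₀ _ (by positivity)] at this
  intro k
  induction k with
  | zero =>
    exact fun x => exists_isMild_const_of_norm_le (M := M) x (by simp)
      (fun t ht => hM t (ht.trans (by simpa using hτ))) (by simp)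
  | succ k ih =>
    intro x
    obtain ⟨W, hW⟩ := exists_isMild_const_of_norm_le x hδ (fun t ht => hM t (ht.trans hδτ)) hsmall
    obtain ⟨V, hV⟩ := ih (W (τ / (n + 1)))
    have hkδ : 0 ≤ k * (τ / (n + 1)) := by positivity
    have := hW.concat hδ hkδ (isPiecewiseConstant_const hδ B) (isPiecewiseConstant_const hkδ B) hV
    simp only [ite_self] at this
    exact ⟨_, by rwa [Nat.cast_succ, add_one_mul, add_comm]⟩

end ConstantPerturbation

theorem norm_op_sub_defect_le (S : C0Group X) {B : X →L[ℝ] X} (hB : B * B = 0) (x : X) {η : ℝ}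
    (hτ : 0 < τ) (hη : ∀ t ∈ Icc 0 τ, ‖S t x - x‖ ≤ η ∧ ‖S t (B x) - B x‖ ≤ η) {t : ℝ}
    (ht : t ∈ Icc 0 τ) :
    ‖S t x - (x + (t / τ) • B x -
      ∫ s in (0 : ℝ)..t, S (t - s) ((τ⁻¹ • B) (x + (s / τ) • B x)))‖ ≤ 2 * η := by
  have hη₀ : 0 ≤ η := (norm_nonneg _).trans (hη t ht).1
  have hBV : ∀ s, (τ⁻¹ • B) (x + (s / τ) • B x) = τ⁻¹ • B x := fun s => by
    have hBB : B (B x) = 0 := DFunLike.congr_fun hB x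
    simp [hBB]
  have hint : IntervalIntegrable (fun s => S (t - s) (τ⁻¹ • B x)) volume 0 t :=
    (S.continuousOn_op_sub_apply t continuousOn_const).intervalIntegrable
  have hsplit : S t x - (x + (t / τ) • B x - ∫ s in (0 : ℝ)..t, S (t - s) (τ⁻¹ • B x)) =
      (S t x - x) + ∫ s in (0 : ℝ)..t, (S (t - s) (τ⁻¹ • B x) - τ⁻¹ • B x) := by
    rw [intervalIntegral.integral_sub hint intervalIntegrable_const,
      intervalIntegral.integral_const, sub_zero, smul_smul, div_eq_mul_inv]
    abel
  have hbound : ∀ s ∈ uIoc 0 t, ‖S (t - s) (τ⁻¹ • B x) - τ⁻¹ • B x‖ ≤ τ⁻¹ * η := fun s hs => by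
    rw [uIoc_of_le ht.1] at hs
    rw [map_smul, ← smul_sub, norm_smul, Real.norm_of_nonneg (inv_nonneg.2 hτ.le)]
    gcongr
    exact (hη _ ⟨by linarith [hs.2], by linarith [hs.1, ht.2]⟩).2
  simp only [hBV]
  calc _ ≤ η + τ⁻¹ * η * |t - 0| := hsplit ▸ norm_add_le_of_le (hη t ht).1
        (intervalIntegral.norm_integral_le_of_norm_le_const hbound)
    _ ≤ η + τ⁻¹ * η * τ := by
        rw [sub_zero, abs_of_nonneg ht.1]
        gcongr
        exact ht.2
    _ = 2 * η := by field_simp; ring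

/-- A control `τ⁻¹ B` acting during the short time `τ` approximates the jump `x ↦ x + B x`. The
function `V` compared with the solution is the solution without the group, whose velocity is
constant since `B² = 0`. -/
theorem tendsto_isMild_const_inv_smul (S : C0Group X) {B : X →L[ℝ] X} (hB : B * B = 0) (x : X)
    {W : ℝ → ℝ → X} (hW : ∀ τ > 0, IsMild S τ (fun _ => τ⁻¹ • B) x (W τ)) :
    Tendsto (fun τ => W τ τ) (𝓝[>] 0) (𝓝 (x + B x)) := by
  obtain ⟨M, hM⟩ := S.exists_norm_le 1
  refine Metric.tendsto_nhds.2 fun ε hε => ?_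
  obtain ⟨η, hη₀, hη⟩ : ∃ η > 0, 2 * η * Real.exp (M * ‖B‖) < ε :=
    ⟨ε / (4 * Real.exp (M * ‖B‖)), by positivity, by field_simp; norm_num⟩
  have hclose : ∀ z, ∀ᶠ t in 𝓝 (0 : ℝ), ‖S t z - z‖ ≤ η := fun z => by
    have := Metric.tendsto_nhds.1 ((S.continuous_op_apply z).tendsto 0) η hη₀
    simpa only [S.op_zero, one_apply_eq_self, dist_eq_norm] using this.mono fun _ => le_of_lt
  obtain ⟨ρ, hρ₀, hρ⟩ := Metric.eventually_nhds_iff.1 ((hclose x).and (hclose (B x)))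
  filter_upwards [Ioo_mem_nhdsGT (lt_min hρ₀ one_pos)] with τ hτ
  have hτ₀ : 0 < τ := hτ.1
  have hnear : ∀ t ∈ Icc 0 τ, ‖S t x - x‖ ≤ η ∧ ‖S t (B x) - B x‖ ≤ η := fun t ht => hρ <| by
    rw [dist_zero_right, Real.norm_of_nonneg ht.1]
    exact ht.2.trans_lt (hτ.2.trans_le (min_le_left _ _))
  have hMτ : ∀ t ∈ Icc 0 τ, ‖S t‖ ≤ M := fun t ht => hM t <| by
    rw [abs_of_nonneg ht.1]
    exact ht.2.trans (hτ.2.le.trans (min_le_right _ _))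
  have hV : ContinuousOn (fun t => x + (t / τ) • B x) (Icc 0 τ) := by fun_prop
  have hle := norm_sub_le_mul_exp (isPiecewiseConstant_const hτ₀.le (τ⁻¹ • B)) (hW τ hτ₀).1 hV hMτ
    (N := τ⁻¹ * ‖B‖) (δ := 2 * η)
    (fun _ _ => by rw [norm_smul, Real.norm_of_nonneg (inv_nonneg.2 hτ₀.le)])
    (fun t ht => by
      rw [(hW τ hτ₀).sub_integral ht]
      exact norm_op_sub_defect_le S hB x hτ₀ hnear ht) (right_mem_Icc.2 hτ₀.le)
  have hexp : M * (τ⁻¹ * ‖B‖) * τ = M * ‖B‖ := by field_simp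
  rw [div_self hτ₀.ne', one_smul, hexp, ← dist_eq_norm] at hle
  exact hle.trans_lt hη

end MildSolutions

/-! ### Small-time reachability in bilinear control systems -/

section Reachability

variable {X P : Type*} [NormedAddCommGroup X] [NormedSpace ℝ X] [AddCommGroup P] [Module ℝ P]
  {S : C0Group X} {B : P →ₗ[ℝ] X →L[ℝ] X} {τ : ℝ} {F G : X → X}

/-- `F` is the time-`τ` flow of `W' = (A + B p(t)) W` for some piecewise constant control `p`,
where `A` is the generator of the group `S`. -/
def IsFlow (S : C0Group X) (B : P →ₗ[ℝ] X →L[ℝ] X) (τ : ℝ) (F : X → X) : Prop :=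
  0 ≤ τ ∧ ∃ p : ℝ → P, IsPiecewiseConstant τ p ∧
    ∀ x, ∃ W, IsMild S τ (fun s => B (p s)) x W ∧ W τ = F x

theorem isFlow_op (S : C0Group X) (B : P →ₗ[ℝ] X →L[ℝ] X) (hτ : 0 ≤ τ) : IsFlow S B τ (S τ) := by
  refine ⟨hτ, fun _ => 0, isPiecewiseConstant_const hτ 0, fun x => ⟨fun t => S t x, ?_, rfl⟩⟩
  simpa only [map_zero] using! isMild_zero S τ x

/-- The states reachable from `x` in time less than `T`. -/
def reachableSet (S : C0Group X) (B : P →ₗ[ℝ] X →L[ℝ] X) (T : ℝ) (x : X) : Set X :=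
  {y | ∃ τ ∈ Ico 0 T, ∃ F, IsFlow S B τ F ∧ F x = y}

theorem op_mem_reachableSet (S : C0Group X) (B : P →ₗ[ℝ] X →L[ℝ] X) {t T : ℝ} (ht : t ∈ Ico 0 T)
    (x : X) : S t x ∈ reachableSet S B T x :=
  ⟨t, ht, _, isFlow_op S B ht.1, rfl⟩

/-- Conjugating `S t` by `1 ± t ^ (-1/2) J` and letting `t → 0` produces the operator
`exp (-J A J)`, where `A` is the generator of `S`. -/
theorem tendsto_conj_op {J K : X →L[ℝ] X} (hJ : J * J = 0) {x y : X} {c : ℝ}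
    (hslope : Tendsto (fun t => t⁻¹ • (S t (J x) - J x)) (𝓝[>] 0) (𝓝 y)) (hy : J y = K x)
    (hlip : ∀ t > 0, ‖J (S t x - x)‖ ≤ c * t) :
    Tendsto (fun t => (1 + (-(√t)⁻¹) • J) (S t ((1 + (√t)⁻¹ • J) x))) (𝓝[>] 0)
      (𝓝 ((1 - K) x)) := by
  have hJJ : ∀ z, J (J z) = 0 := DFunLike.congr_fun hJ
  have hsqrt : Tendsto (fun t : ℝ => √t) (𝓝[>] 0) (𝓝 0) := by
    simpa using (Real.continuous_sqrt.tendsto 0).mono_left nhdsWithin_le_nhds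
  have hop : Tendsto (fun t => S t x) (𝓝[>] 0) (𝓝 x) := by
    simpa [S.op_zero] using ((S.continuous_op_apply x).tendsto 0).mono_left nhdsWithin_le_nhds
  have hfirst : Tendsto (fun t => √t • (t⁻¹ • (S t (J x) - J x))) (𝓝[>] 0) (𝓝 0) := by
    simpa only [zero_smul] using hsqrt.smul hslope
  have hsecond : Tendsto (fun t => (√t)⁻¹ • J (S t x - x)) (𝓝[>] 0) (𝓝 0) := by
    refine squeeze_zero_norm' ?_ (by simpa only [mul_zero] using hsqrt.const_mul c)
    filter_upwards [self_mem_nhdsWithin] with t ht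
    have hst : 0 < √t := Real.sqrt_pos.2 ht
    rw [norm_smul, norm_inv, Real.norm_of_nonneg hst.le, inv_mul_le_iff₀ hst]
    exact (hlip t ht).trans_eq (by rw [mul_left_comm, Real.mul_self_sqrt (le_of_lt ht)])
  have hthird : Tendsto (fun t => J (t⁻¹ • (S t (J x) - J x))) (𝓝[>] 0) (𝓝 (K x)) := by
    exact hy ▸ (J.continuous.tendsto y).comp hslope
  have hsum := ((hop.add hfirst).sub hsecond).sub hthird
  rw [add_zero, sub_zero] at hsum
  refine hsum.congr' ?_
  filter_upwards [self_mem_nhdsWithin] with t ht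
  have hroot : √t * t⁻¹ = (√t)⁻¹ := by rw [← div_eq_mul_inv, Real.sqrt_div_self]
  have hinv : t⁻¹ = (√t)⁻¹ * (√t)⁻¹ := by rw [← mul_inv, Real.mul_self_sqrt (le_of_lt ht)]
  rw [smul_smul, hroot, hinv]
  simp only [_root_.add_apply, _root_.smul_apply, one_apply_eq_self, map_add, map_sub, map_smul,
    hJJ]
  module

variable [CompleteSpace X]

theorem IsFlow.continuous (hF : IsFlow S B τ F) : Continuous F := by
  obtain ⟨hτ, p, hp, hF⟩ := hF
  obtain ⟨L, hL⟩ := exists_norm_sub_le S hτ (hp.comp B)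
  refine (LipschitzWith.of_dist_le' (K := L) fun x y => ?_).continuous
  obtain ⟨W, hW, hWF⟩ := hF x
  obtain ⟨V, hV, hVF⟩ := hF y
  rw [dist_eq_norm, dist_eq_norm, ← hWF, ← hVF]
  exact hL x y W V hW hV

theorem IsFlow.comp {σ : ℝ} (hG : IsFlow S B σ G) (hF : IsFlow S B τ F) :
    IsFlow S B (τ + σ) (G ∘ F) := by
  obtain ⟨hτ, p, hp, hF⟩ := hF
  obtain ⟨hσ, q, hq, hG⟩ := hG
  refine ⟨add_nonneg hτ hσ, _, hp.concat hq, fun x => ?_⟩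
  obtain ⟨W, hW, hWF⟩ := hF x
  obtain ⟨V, hV, hVG⟩ := hG (F x)
  rw [← hWF] at hV
  refine ⟨fun t => if t ≤ τ then W t else V (t - τ), ?_, ?_⟩
  · simpa only [apply_ite B] using hW.concat hτ hσ (hp.comp B) (hq.comp B) hV
  · beta_reduce
    rw [ite_le_eq_of_ge (hV.apply_zero hσ) (le_add_of_nonneg_right hσ), add_sub_cancel_left, hVG,
      Function.comp_apply]

theorem closure_reachableSet_subset {T₁ T₂ : ℝ} {x y : X}
    (hy : y ∈ closure (reachableSet S B T₁ x)) :
    closure (reachableSet S B T₂ y) ⊆ closure (reachableSet S B (T₁ + T₂) x) := by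
  refine closure_minimal ?_ isClosed_closure
  rintro _ ⟨σ, hσ, G, hG, rfl⟩
  refine map_mem_closure hG.continuous hy ?_
  rintro _ ⟨τ, hτ, F, hF, rfl⟩
  exact ⟨τ + σ, ⟨add_nonneg hτ.1 hσ.1, add_lt_add hτ.2 hσ.2⟩, _, hG.comp hF, rfl⟩

/-- The operators that can be approximated, pointwise, by flows of arbitrarily small time. The
control may depend on the state. -/
def smallTimeReachable (S : C0Group X) (B : P →ₗ[ℝ] X →L[ℝ] X) : Submonoid (X →L[ℝ] X) where
  carrier := {F | ∀ T > 0, ∀ x, F x ∈ closure (reachableSet S B T x)}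
  one_mem' T hT x := by
    refine subset_closure ?_
    simpa only [S.op_zero] using op_mem_reachableSet S B (left_mem_Ico.2 hT) x
  mul_mem' {F G} hF hG T hT x := by
    have := closure_reachableSet_subset (hG (T / 2) (half_pos hT) x)
      (hF (T / 2) (half_pos hT) (G x))
    rwa [add_halves] at this

theorem isClosed_smallTimeReachable :
    IsClosed (smallTimeReachable S B : Set (X →L[ℝ] X)) :=
  isClosed_of_closure_subset fun G hG T hT x => by
    have hclosure : G x ∈ closure (closure (reachableSet S B T x)) :=
      map_mem_closure (f := fun F : X →L[ℝ] X => F x) (continuous_eval_const x) hG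
        fun _ hF => hF T hT x
    rwa [closure_closure] at hclosure

theorem one_add_mem_smallTimeReachable {q : P} (hq : B q * B q = 0) :
    1 + B q ∈ smallTimeReachable S B := by
  have hex : ∀ τ x, ∃ W, 0 < τ → IsMild S τ (fun _ => τ⁻¹ • B q) x W := by
    intro τ x
    by_cases hτ : 0 < τ
    · exact (exists_isMild_const S _ hτ.le x).imp fun W hW _ => hW
    · exact ⟨0, fun h => absurd h hτ⟩
  choose W hW using hex
  intro T hT x
  refine isClosed_closure.mem_of_tendsto
    (tendsto_isMild_const_inv_smul S hq x fun τ hτ => hW τ x hτ) ?_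
  filter_upwards [Ioo_mem_nhdsGT hT] with τ hτ
  refine subset_closure ⟨τ, ⟨hτ.1.le, hτ.2⟩, fun x => W τ x τ, ?_, rfl⟩
  refine ⟨hτ.1.le, fun _ => τ⁻¹ • q, isPiecewiseConstant_const hτ.1.le _, fun x => ⟨W τ x, ?_, rfl⟩⟩
  simpa only [map_smul] using hW τ x hτ.1

theorem one_sub_mem_smallTimeReachable {J K : X →L[ℝ] X} (hJ : J * J = 0)
    (hmem : ∀ c : ℝ, 1 + c • J ∈ smallTimeReachable S B)
    (hslope : ∀ x, ∃ y, Tendsto (fun t => t⁻¹ • (S t (J x) - J x)) (𝓝[>] 0) (𝓝 y) ∧ J y = K x)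
    (hlip : ∀ x, ∃ c, ∀ t > 0, ‖J (S t x - x)‖ ≤ c * t) : 1 - K ∈ smallTimeReachable S B := by
  intro T hT x
  obtain ⟨y, hy, hJy⟩ := hslope x
  obtain ⟨c, hc⟩ := hlip x
  refine isClosed_closure.mem_of_tendsto (tendsto_conj_op hJ hy hJy hc) ?_
  have hT' : 0 < T / 3 := by positivity
  filter_upwards [Ioo_mem_nhdsGT hT'] with t ht
  have h₁ := hmem (√t)⁻¹ (T / 3) hT' x
  have h₂ := closure_reachableSet_subset h₁
    (subset_closure (op_mem_reachableSet S B ⟨ht.1.le, ht.2⟩ _))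
  have h₃ := closure_reachableSet_subset h₂ (hmem (-(√t)⁻¹) (T / 3) hT' _)
  rwa [add_thirds] at h₃

end Reachability

/-! ### Fourier series on the torus -/

section Fourier

variable {d : ℕ}

/-- The exponential monomial `e^{i k·x}`. -/
def monomial (k : Fin d → ℤ) : C(Torus d, ℂ) where
  toFun x := ∏ i, fourier (k i) (x i)
  continuous_toFun := by fun_prop

theorem monomial_apply (k : Fin d → ℤ) (x : Torus d) :
    monomial k x = ∏ i, (fourier (k i) (x i) : ℂ) := rfl

theorem monomial_add (k l : Fin d → ℤ) (x : Torus d) :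
    monomial (k + l) x = monomial k x * monomial l x := by
  simp [monomial_apply, Finset.prod_mul_distrib]

theorem monomial_neg (k : Fin d → ℤ) (x : Torus d) : monomial (-k) x = conj (monomial k x) := by
  simp [monomial_apply, map_prod]

theorem norm_monomial_apply (k : Fin d → ℤ) (x : Torus d) : ‖monomial k x‖ = 1 := by
  rw [monomial_apply, norm_prod]
  exact Finset.prod_eq_one fun i _ => by rw [fourier_apply, Circle.norm_coe]

theorem fourier_homeomorphAddCircle {p q : ℝ} (hp : p ≠ 0) (hq : q ≠ 0) (n : ℤ) (x : AddCircle p) :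
    fourier n (AddCircle.homeomorphAddCircle p q hp hq x) = fourier n x := by
  induction x using QuotientAddGroup.induction_on with
  | H y =>
    have hp' : (p : ℂ) ≠ 0 := Complex.ofReal_ne_zero.2 hp
    have hq' : (q : ℂ) ≠ 0 := Complex.ofReal_ne_zero.2 hq
    rw [AddCircle.homeomorphAddCircle_apply_mk, fourier_coe_apply, fourier_coe_apply]
    congr 1
    push_cast
    field_simp

theorem topologicalClosure_span_monomial :
    (Submodule.span ℂ (range (monomial (d := d)))).topologicalClosure = ⊤ := by
  let h : Torus d ≃ₜ UnitAddTorus (Fin d) := Homeomorph.piCongrRight fun _ =>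
    AddCircle.homeomorphAddCircle (2 * Real.pi) 1 Real.two_pi_pos.ne' one_ne_zero
  let pullback : C(UnitAddTorus (Fin d), ℂ) →L[ℂ] C(Torus d, ℂ) :=
    ContinuousMap.compCLM ℂ ℂ (h : C(Torus d, UnitAddTorus (Fin d)))
  have hsurj : Function.Surjective pullback := fun f =>
    ⟨f.comp (h.symm : C(UnitAddTorus (Fin d), Torus d)),
      ContinuousMap.ext fun x => congrArg f (h.symm_apply_apply x)⟩
  have hmonomial : ∀ k, pullback (UnitAddTorus.mFourier k) = monomial k := fun k => by
    ext x
    change ∏ i, fourier (k i) (h x i) = ∏ i, fourier (k i) (x i)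
    exact Finset.prod_congr rfl fun i _ => fourier_homeomorphAddCircle _ _ (k i) (x i)
  simpa only [Submodule.map_span, ContinuousLinearMap.coe_coe, ← range_comp, Function.comp_def,
    hmonomial] using
    hsurj.denseRange.topologicalClosure_map_submodule UnitAddTorus.span_mFourier_closure_eq_top

theorem two_pi_rpow_ne_zero (a : ℝ) : (((2 * Real.pi) ^ a : ℝ) : ℂ) ≠ 0 :=
  Complex.ofReal_ne_zero.2 (Real.rpow_pos_of_pos Real.two_pi_pos _).ne'

theorem eigenfunction_eq_smul_monomial (k : Fin d → ℤ) :
    eigenfunction k = (((2 * Real.pi) ^ (-(d : ℝ) / 2) : ℝ) : ℂ) • monomial k := rfl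

theorem topologicalClosure_span_eigenfunction :
    (Submodule.span ℂ (range (eigenfunction (d := d)))).topologicalClosure = ⊤ := by
  rw [eq_top_iff, ← topologicalClosure_span_monomial]
  refine Submodule.topologicalClosure_mono (Submodule.span_le.2 ?_)
  rintro _ ⟨k, rfl⟩
  have hk : eigenfunction k ∈ Submodule.span ℂ (range (eigenfunction (d := d))) :=
    Submodule.subset_span ⟨k, rfl⟩
  rwa [eigenfunction_eq_smul_monomial, Submodule.smul_mem_iff _ (two_pi_rpow_ne_zero _)] at hk

/-- The complex Hilbert space `L²(𝕋^d, ℂ)`, in which Fourier series are expanded. -/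
abbrev ComplexL2 (d : ℕ) : Type := Lp ℂ 2 (volume : Measure (Torus d))

/-- The eigenfunction `φ_k` as an element of `L²(𝕋^d, ℂ)`. -/
abbrev eigenLp (k : Fin d → ℤ) : ComplexL2 d :=
  ContinuousMap.toLp (E := ℂ) 2 volume ℂ (eigenfunction k)

theorem coeFn_eigenLp (k : Fin d → ℤ) : eigenLp k =ᵐ[volume] eigenfunction k :=
  ContinuousMap.coeFn_toLp _ _

theorem inner_eigenLp (k : Fin d → ℤ) (f : ComplexL2 d) :
    inner ℂ (eigenLp k) f = ∫ x, conj (eigenfunction k x) * f x := by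
  rw [L2.inner_def]
  refine integral_congr_ae ?_
  filter_upwards [coeFn_eigenLp k] with x hx
  rw [hx, RCLike.inner_apply, mul_comm]

theorem topologicalClosure_span_eigenLp :
    (Submodule.span ℂ (range (eigenLp (d := d)))).topologicalClosure = ⊤ := by
  simpa only [Submodule.map_span, ContinuousLinearMap.coe_coe, ← range_comp,
    Function.comp_def] using
    (ContinuousMap.toLp_denseRange ℂ (volume : Measure (Torus d)) ℂ
      (p := 2) ENNReal.ofNat_ne_top).topologicalClosure_map_submodule
        topologicalClosure_span_eigenfunction

theorem volume_real_torus : (volume : Measure (Torus d)).real univ = (2 * Real.pi) ^ d := by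
  rw [Measure.real, volume_pi, Measure.pi_univ]
  simp [AddCircle.measure_univ, Real.pi_pos.le]

theorem integral_conj_eigenfunction_mul_self (k : Fin d → ℤ) :
    ∫ x : Torus d, conj (eigenfunction k x) * eigenfunction k x = 1 := by
  have hsq : ∀ x : Torus d, conj (eigenfunction k x) * eigenfunction k x =
      (((2 * Real.pi) ^ (-(d : ℝ)) : ℝ) : ℂ) := fun x => by
    rw [← Complex.normSq_eq_conj_mul_self, Complex.normSq_eq_norm_sq,
      eigenfunction_eq_smul_monomial, ContinuousMap.smul_apply, norm_smul, norm_monomial_apply,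
      mul_one, Complex.norm_real, Real.norm_eq_abs, sq_abs, ← Real.rpow_mul_natCast (by positivity)]
    norm_num
  simp only [hsq]
  rw [integral_const, volume_real_torus, ← Real.rpow_natCast, Complex.real_smul,
    ← Complex.ofReal_mul, ← Real.rpow_add Real.two_pi_pos, add_neg_cancel, Real.rpow_zero,
    Complex.ofReal_one]

theorem orthonormal_eigenLp : Orthonormal ℂ (eigenLp (d := d)) := by
  rw [orthonormal_iff_ite]
  intro j k
  have hint : inner ℂ (eigenLp j) (eigenLp k) =
      ∫ x, conj (eigenfunction j x) * eigenfunction k x := by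
    rw [inner_eigenLp]
    refine integral_congr_ae ?_
    filter_upwards [coeFn_eigenLp k] with x hx using by rw [hx]
  rw [hint]
  split_ifs with h
  · rw [h, integral_conj_eigenfunction_mul_self]
  · exact integral_conj_eigenfunction_mul h

/-- The Hilbert basis `(φ_k)` of `L²(𝕋^d, ℂ)`. -/
def eigenBasis (d : ℕ) : HilbertBasis (Fin d → ℤ) ℂ (ComplexL2 d) :=
  HilbertBasis.mk orthonormal_eigenLp topologicalClosure_span_eigenLp.ge

theorem eigenBasis_apply (k : Fin d → ℤ) : eigenBasis d k = eigenLp k := by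
  rw [eigenBasis, HilbertBasis.coe_mk]

/-- The inclusion of the real in the complex `L²` space. -/
abbrev complexify : L2 d →L[ℝ] ComplexL2 d := Complex.ofRealCLM.compLpL 2 volume

/-- The real part, from the complex to the real `L²` space. -/
abbrev realPart : ComplexL2 d →L[ℝ] L2 d := Complex.reCLM.compLpL 2 volume

theorem coeFn_complexify (w : L2 d) : complexify w =ᵐ[volume] fun x => ((w x : ℝ) : ℂ) :=
  Complex.ofRealCLM.coeFn_compLpL w

theorem coeFn_realPart (f : ComplexL2 d) : realPart f =ᵐ[volume] fun x => (f x).re :=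
  Complex.reCLM.coeFn_compLpL f

theorem realPart_complexify (w : L2 d) : realPart (complexify w) = w := by
  refine Lp.ext ?_
  filter_upwards [coeFn_complexify w, coeFn_realPart (complexify w)] with x h₁ h₂
  rw [h₂, h₁, Complex.ofReal_re]

theorem norm_complexify (w : L2 d) : ‖complexify w‖ = ‖w‖ := by
  have hae : ∀ᵐ x, ‖complexify w x‖ = ‖w x‖ := by
    filter_upwards [coeFn_complexify w] with x hx
    rw [hx, Complex.norm_real]
  exact le_antisymm (Lp.norm_le_norm_of_ae_le (hae.mono fun _ => le_of_eq))
    (Lp.norm_le_norm_of_ae_le (hae.mono fun _ => ge_of_eq))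

theorem eigenBasis_repr_complexify (w : L2 d) (k : Fin d → ℤ) :
    (eigenBasis d).repr (complexify w) k = coeff w k := by
  rw [HilbertBasis.repr_apply_apply, eigenBasis_apply, coeff_eq_inner]

theorem hasSum_norm_coeff_sq (w : L2 d) : HasSum (fun k => ‖coeff w k‖ ^ 2) (‖w‖ ^ 2) := by
  simpa only [ENNReal.toReal_ofNat, Real.rpow_ofNat, LinearIsometryEquiv.norm_map,
    eigenBasis_repr_complexify, norm_complexify] using
    lp.hasSum_norm (p := 2) (by norm_num) ((eigenBasis d).repr (complexify w))

theorem hasSum_coeff_smul_eigenLp (w : L2 d) :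
    HasSum (fun k => coeff w k • eigenLp k) (complexify w) := by
  simpa only [eigenBasis_repr_complexify, eigenBasis_apply] using
    (eigenBasis d).hasSum_repr (complexify w)

theorem modeL2_eq_realPart (k : Fin d → ℤ) (a : ℂ) : modeL2 k a = realPart (a • eigenLp k) := by
  refine Lp.ext ?_
  filter_upwards [coeFn_realPart (a • eigenLp k), Lp.coeFn_smul a (eigenLp k), coeFn_eigenLp k,
    ContinuousMap.coeFn_toLp (p := 2) (E := ℝ) (𝕜 := ℝ) volume (mode k a)] with x h₁ h₂ h₃ h₄
  rw [h₁, h₂, Pi.smul_apply, h₃, modeL2, h₄]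
  rfl

theorem hasSum_modeL2 (w : L2 d) : HasSum (fun k => modeL2 k (coeff w k)) w := by
  simpa only [modeL2_eq_realPart, realPart_complexify] using
    (hasSum_coeff_smul_eigenLp w).mapL realPart

theorem ext_coeff {v w : L2 d} (h : ∀ k, coeff v k = coeff w k) : v = w :=
  (hasSum_modeL2 v).unique (by simpa only [h] using hasSum_modeL2 w)

theorem coeff_neg_index (w : L2 d) (k : Fin d → ℤ) : coeff w (-k) = conj (coeff w k) := by
  rw [coeff, coeff, ← integral_conj]
  simp only [conj_eigenfunction, map_mul, Complex.conj_ofReal, neg_neg]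

theorem coeff_realPart (f : ComplexL2 d) (k : Fin d → ℤ) :
    coeff (realPart f) k = ((eigenBasis d).repr f k + conj ((eigenBasis d).repr f (-k))) / 2 := by
  have hint : ∀ j, Integrable fun x => conj (eigenfunction j x) * f x := fun j =>
    (L2.integrable_inner (𝕜 := ℂ) (eigenLp j) f).congr <| by
      filter_upwards [coeFn_eigenLp j] with x hx
      rw [hx, RCLike.inner_apply, mul_comm]
  simp only [HilbertBasis.repr_apply_apply, eigenBasis_apply, inner_eigenLp]
  rw [← integral_conj, ← integral_add (hint k), ← integral_div, coeff]
  · refine integral_congr_ae ?_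
    filter_upwards [coeFn_realPart f] with x hx
    rw [hx, Complex.re_eq_add_conj, map_mul, ← conj_eigenfunction, Complex.conj_conj]
    ring
  · exact Complex.conjCLE.toContinuousLinearMap.integrable_comp (hint (-k))

theorem coeff_modeL2 (k j : Fin d → ℤ) (a : ℂ) :
    coeff (modeL2 k a) j = (if j = k then a / 2 else 0) + if j = -k then conj a / 2 else 0 := by
  have hrepr : ∀ j, (eigenBasis d).repr (a • eigenLp k) j = if j = k then a else 0 := fun j => by
    rw [HilbertBasis.repr_apply_apply, eigenBasis_apply, inner_smul_right,
      orthonormal_iff_ite.1 orthonormal_eigenLp, mul_ite, mul_one, mul_zero]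
  rw [modeL2_eq_realPart, coeff_realPart, hrepr, hrepr, add_div, apply_ite conj, map_zero, ite_div,
    ite_div, zero_div]
  simp only [neg_eq_iff_eq_neg]

theorem exists_coeff_eq {c : (Fin d → ℤ) → ℂ} (hc : Summable fun k => ‖c k‖ ^ 2)
    (hs : ∀ k, c (-k) = conj (c k)) : ∃ w : L2 d, ∀ k, coeff w k = c k := by
  have hc₂ : Memℓp c 2 := memℓp_gen (by simpa using hc)
  refine ⟨realPart ((eigenBasis d).repr.symm ⟨c, hc₂⟩), fun k => ?_⟩
  rw [coeff_realPart, LinearIsometryEquiv.apply_symm_apply]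
  change (c k + conj (c (-k))) / 2 = c k
  rw [hs, Complex.conj_conj, add_self_div_two]

end Fourier

/-! ### Fourier coefficients of states -/

section States

variable {d : ℕ}

theorem coeff_zero (k : Fin d → ℤ) : coeff (0 : L2 d) k = 0 := by
  rw [coeff_eq_inner, map_zero, inner_zero_right]

theorem coeff_sub (v w : L2 d) (k : Fin d → ℤ) : coeff (v - w) k = coeff v k - coeff w k := by
  rw [eq_sub_iff_add_eq, ← coeff_add, sub_add_cancel]

theorem freq_sq (k : Fin d → ℤ) : freq k ^ 2 = eigenvalue k := Real.sq_sqrt (eigenvalue_nonneg k)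

theorem eigenvalue_neg (k : Fin d → ℤ) : eigenvalue (-k) = eigenvalue k := by simp [eigenvalue]

theorem freq_neg (k : Fin d → ℤ) : freq (-k) = freq k := by rw [freq, eigenvalue_neg, freq]

theorem freqSeq_modeH1 (k : Fin d → ℤ) (a : ℂ) :
    H1.freqSeq (modeH1 k a) =
      (1 / 2 : ℝ) • (lp.single 2 k ((freq k : ℂ) * a) + lp.single 2 (-k) (freq (-k) * conj a)) := by
  ext j
  rw [show H1.freqSeq (modeH1 k a) j = (freq j : ℂ) * coeff (modeL2 k a) j from rfl, coeff_modeL2,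
    lp.coeFn_smul, Pi.smul_apply, lp.coeFn_add, Pi.add_apply, lp.single_apply, lp.single_apply,
    Pi.single_apply, Pi.single_apply, Complex.real_smul, mul_add, mul_add, mul_ite, mul_ite,
    mul_ite, mul_ite]
  congr 1 <;>
  · refine ite_congr rfl (fun h => ?_) fun _ => by simp
    rw [h]
    push_cast
    ring

theorem isometry_graph : Isometry (H1.graph (d := d)) :=
  AddMonoidHomClass.isometry_of_norm _ fun _ => rfl

theorem hasSum_modeH1 (w : H1 d) : HasSum (fun k => modeH1 k (coeff w.toL2 k)) w := by
  rw [← isometry_graph.isUniformInducing.isInducing.hasSum_iff]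
  have hsingle : HasSum (fun k => lp.single 2 k (H1.freqSeq w k)) (H1.freqSeq w) :=
    lp.hasSum_single ENNReal.ofNat_ne_top _
  have hfreq : HasSum (fun k => H1.freqSeq (modeH1 k (coeff w.toL2 k))) (H1.freqSeq w) := by
    convert! (hsingle.add ((Equiv.neg _).hasSum_iff.2 hsingle)).const_smul (1 / 2 : ℝ) using 1
    · funext k
      rw [freqSeq_modeH1, ← coeff_neg_index]
      rfl
    · rw [← two_smul ℝ, smul_smul, one_div_mul_cancel two_ne_zero, one_smul]
  exact ((hasSum_modeL2 w.toL2).prodMk hfreq).mapL (WithLp.prodContinuousLinearEquiv 2 ℝ (L2 d)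
    (lp (fun _ : Fin d → ℤ => ℂ) 2)).symm.toContinuousLinearMap

theorem hasSum_modeState (W : State d) :
    HasSum (fun k => mkState (modeH1 k (coeff W.fst.toL2 k)) (modeL2 k (coeff W.snd k))) W :=
  ((hasSum_modeH1 W.fst).prodMk (hasSum_modeL2 W.snd)).mapL
    (WithLp.prodContinuousLinearEquiv 2 ℝ (H1 d) (L2 d)).symm.toContinuousLinearMap

theorem state_ext_coeff {V W : State d} (hfst : ∀ k, coeff V.fst.toL2 k = coeff W.fst.toL2 k)
    (hsnd : ∀ k, coeff V.snd k = coeff W.snd k) : V = W :=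
  WithLp.ofLp_injective 2 <| Prod.ext (H1.toL2_injective (ext_coeff hfst)) (ext_coeff hsnd)

/-- The contribution of the frequency `k` to the squared norm of the state whose Fourier
coefficients at `k` are `a` (profile) and `b` (velocity). -/
def modeEnergy (k : Fin d → ℤ) (a b : ℂ) : ℝ := (1 + eigenvalue k) * ‖a‖ ^ 2 + ‖b‖ ^ 2

theorem modeEnergy_nonneg (k : Fin d → ℤ) (a b : ℂ) : 0 ≤ modeEnergy k a b := by
  have := eigenvalue_nonneg k
  unfold modeEnergy
  positivity

theorem modeEnergy_sub_le (k : Fin d → ℤ) (a b a' b' : ℂ) :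
    modeEnergy k (a - a') (b - b') ≤ 2 * (modeEnergy k a b + modeEnergy k a' b') := by
  have hsub : ∀ u v : ℂ, ‖u - v‖ ^ 2 ≤ 2 * (‖u‖ ^ 2 + ‖v‖ ^ 2) := fun u v =>
    (pow_le_pow_left₀ (norm_nonneg _) (norm_sub_le u v) 2).trans add_sq_le
  have hk : 0 ≤ 1 + eigenvalue k := add_nonneg zero_le_one (eigenvalue_nonneg k)
  unfold modeEnergy
  linarith [mul_le_mul_of_nonneg_left (hsub a a') hk, hsub b b']

theorem hasSum_modeEnergy (W : State d) :
    HasSum (fun k => modeEnergy k (coeff W.fst.toL2 k) (coeff W.snd k)) (‖W‖ ^ 2) := by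
  rw [WithLp.prod_norm_sq_eq_of_L2, H1.norm_sq]
  simpa only [modeEnergy, add_mul, one_mul] using
    ((hasSum_norm_coeff_sq W.fst.toL2).add W.fst.summable.hasSum).add (hasSum_norm_coeff_sq W.snd)

theorem exists_state_coeff_eq {a b : (Fin d → ℤ) → ℂ}
    (hab : Summable fun k => modeEnergy k (a k) (b k)) (ha : ∀ k, a (-k) = conj (a k))
    (hb : ∀ k, b (-k) = conj (b k)) :
    ∃ W : State d, (∀ k, coeff W.fst.toL2 k = a k) ∧ ∀ k, coeff W.snd k = b k := by
  have hparts : ∀ k, 0 ≤ ‖a k‖ ^ 2 ∧ 0 ≤ eigenvalue k * ‖a k‖ ^ 2 ∧ 0 ≤ ‖b k‖ ^ 2 := fun k =>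
    ⟨by positivity, mul_nonneg (eigenvalue_nonneg k) (by positivity), by positivity⟩
  obtain ⟨w, hw⟩ := exists_coeff_eq (c := a) (hab.of_nonneg_of_le (fun k => (hparts k).1)
    fun k => by unfold modeEnergy; linarith [hparts k]) ha
  obtain ⟨v, hv⟩ := exists_coeff_eq (c := b) (hab.of_nonneg_of_le (fun k => (hparts k).2.2)
    fun k => by unfold modeEnergy; linarith [hparts k]) hb
  refine ⟨mkState ⟨w, ?_⟩ v, hw, hv⟩
  refine hab.of_nonneg_of_le (fun k => ?_) fun k => ?_ <;> rw [hw]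
  · exact (hparts k).2.1
  · unfold modeEnergy
    linarith [hparts k]

theorem tendsto_of_coeff {ι : Type*} {l : Filter ι} {Z : ι → State d} {Z₀ : State d}
    {g : (Fin d → ℤ) → ℝ} (hg : Summable g)
    (hle : ∀ᶠ i in l, ∀ k, modeEnergy k (coeff (Z i).fst.toL2 k) (coeff (Z i).snd k) ≤ g k)
    (hfst : ∀ k, Tendsto (fun i => coeff (Z i).fst.toL2 k) l (𝓝 (coeff Z₀.fst.toL2 k)))
    (hsnd : ∀ k, Tendsto (fun i => coeff (Z i).snd k) l (𝓝 (coeff Z₀.snd k))) :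
    Tendsto Z l (𝓝 Z₀) := by
  let defect (i : ι) (k : Fin d → ℤ) : ℝ := modeEnergy k
    (coeff (Z i).fst.toL2 k - coeff Z₀.fst.toL2 k) (coeff (Z i).snd k - coeff Z₀.snd k)
  have hnorm : ∀ i, HasSum (defect i) (‖Z i - Z₀‖ ^ 2) := fun i => by
    simpa only [WithLp.sub_fst, WithLp.sub_snd, map_sub, coeff_sub] using
      hasSum_modeEnergy (Z i - Z₀)
  have hterm : ∀ k, Tendsto (fun i => defect i k) l (𝓝 0) := fun k => by
    simpa [defect, modeEnergy] using
      ((((hfst k).sub_const (coeff Z₀.fst.toL2 k)).norm.pow 2).const_mul (1 + eigenvalue k)).add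
        (((hsnd k).sub_const (coeff Z₀.snd k)).norm.pow 2)
  have hsum := tendsto_tsum_of_dominated_convergence
    ((hg.add (hasSum_modeEnergy Z₀).summable).mul_left 2) hterm (by
      filter_upwards [hle] with i hi k
      rw [Real.norm_of_nonneg (modeEnergy_nonneg _ _ _)]
      exact (modeEnergy_sub_le k _ _ _ _).trans (by gcongr; exact hi k))
  rw [tendsto_iff_norm_sub_tendsto_zero]
  simpa [fun i => (hnorm i).tsum_eq] using hsum.sqrt

end States

/-! ### The free wave group -/

section FreeWave

variable {d : ℕ}

/-- The multiplier `sin (t √λ_k) / √λ_k`, equal to `t` at `k = 0`. -/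
def sincCoeff (t : ℝ) (k : Fin d → ℤ) : ℝ := if k = 0 then t else Real.sin (freq k * t) / freq k

theorem freq_pos {k : Fin d → ℤ} (hk : k ≠ 0) : 0 < freq k := by
  obtain ⟨i, hi⟩ := Function.ne_iff.1 hk
  exact Real.sqrt_pos.2 <| Finset.sum_pos' (fun _ _ => sq_nonneg _)
    ⟨i, Finset.mem_univ i, sq_pos_of_ne_zero (Int.cast_ne_zero.2 hi)⟩

theorem freq_nonneg (k : Fin d → ℤ) : 0 ≤ freq k := Real.sqrt_nonneg _

theorem freq_mul_sincCoeff (t : ℝ) (k : Fin d → ℤ) :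
    freq k * sincCoeff t k = Real.sin (freq k * t) := by
  by_cases hk : k = 0
  · simp [hk, freq, eigenvalue]
  · rw [sincCoeff, if_neg hk, mul_div_cancel₀ _ (freq_pos hk).ne']

theorem abs_sincCoeff_le (t : ℝ) (k : Fin d → ℤ) : |sincCoeff t k| ≤ |t| := by
  by_cases hk : k = 0
  · simp [sincCoeff, hk]
  · rw [sincCoeff, if_neg hk, abs_div, abs_of_pos (freq_pos hk), div_le_iff₀ (freq_pos hk)]
    exact Real.abs_sin_le_abs.trans_eq (by rw [abs_mul, abs_of_pos (freq_pos hk), mul_comm])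

theorem sincCoeff_sq_le (t : ℝ) (k : Fin d → ℤ) : sincCoeff t k ^ 2 ≤ t ^ 2 :=
  sq_le_sq.2 (abs_sincCoeff_le t k)

theorem sincCoeff_zero (k : Fin d → ℤ) : sincCoeff 0 k = 0 := by simp [sincCoeff]

theorem sincCoeff_neg (t : ℝ) (k : Fin d → ℤ) : sincCoeff t (-k) = sincCoeff t k := by
  simp [sincCoeff, freq_neg]

theorem sincCoeff_add (s t : ℝ) (k : Fin d → ℤ) : sincCoeff (s + t) k =
    Real.cos (freq k * s) * sincCoeff t k + sincCoeff s k * Real.cos (freq k * t) := by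
  by_cases hk : k = 0
  · simp [sincCoeff, hk, freq, eigenvalue, add_comm]
  · simp only [sincCoeff, if_neg hk, mul_add, Real.sin_add]
    ring

theorem hasDerivAt_sincCoeff (t : ℝ) (k : Fin d → ℤ) :
    HasDerivAt (fun t => sincCoeff t k) (Real.cos (freq k * t)) t := by
  by_cases hk : k = 0
  · simpa [sincCoeff, hk, freq, eigenvalue] using hasDerivAt_id' t
  · simp only [sincCoeff, if_neg hk]
    convert! (((hasDerivAt_id' t).const_mul (freq k)).sin).div_const (freq k) using 1
    have := (freq_pos hk).ne'
    field_simp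

theorem profileCoeff_eq (t : ℝ) (W : State d) (k : Fin d → ℤ) : profileCoeff t W k =
    (Real.cos (freq k * t) : ℂ) * coeff W.fst.toL2 k + (sincCoeff t k : ℂ) * coeff W.snd k := rfl

theorem norm_real_combination_sq_le (a b : ℝ) (x y : ℂ) :
    ‖(a : ℂ) * x + (b : ℂ) * y‖ ^ 2 ≤ 2 * (a ^ 2 * ‖x‖ ^ 2 + b ^ 2 * ‖y‖ ^ 2) := by
  refine (pow_le_pow_left₀ (norm_nonneg _) (norm_add_le _ _) 2).trans (add_sq_le.trans_eq ?_)
  simp only [norm_mul, Complex.norm_real, mul_pow, Real.norm_eq_abs, sq_abs]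

theorem norm_sq_add_norm_sq_rotation (θ : ℝ) (x y : ℂ) :
    ‖(Real.cos θ : ℂ) * x + (Real.sin θ : ℂ) * y‖ ^ 2 +
      ‖((-Real.sin θ : ℝ) : ℂ) * x + (Real.cos θ : ℂ) * y‖ ^ 2 = ‖x‖ ^ 2 + ‖y‖ ^ 2 := by
  simp only [Complex.sq_norm, Complex.normSq_apply, Complex.add_re, Complex.add_im,
    Complex.re_ofReal_mul, Complex.im_ofReal_mul]
  linear_combination (x.re ^ 2 + x.im ^ 2 + y.re ^ 2 + y.im ^ 2) * Real.sin_sq_add_cos_sq θ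

theorem energy_conservation (t : ℝ) (W : State d) (k : Fin d → ℤ) :
    eigenvalue k * ‖profileCoeff t W k‖ ^ 2 + ‖velocityCoeff t W k‖ ^ 2 =
      eigenvalue k * ‖coeff W.fst.toL2 k‖ ^ 2 + ‖coeff W.snd k‖ ^ 2 := by
  have hscale : ∀ a : ℂ, eigenvalue k * ‖a‖ ^ 2 = ‖(freq k : ℂ) * a‖ ^ 2 := fun a => by
    rw [norm_mul, mul_pow, Complex.norm_real, Real.norm_eq_abs, sq_abs, freq_sq]
  rw [hscale, hscale, ← norm_sq_add_norm_sq_rotation (freq k * t)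
    ((freq k : ℂ) * coeff W.fst.toL2 k) (coeff W.snd k), profileCoeff_eq, velocityCoeff,
    ← freq_mul_sincCoeff]
  congr 3 <;> (push_cast; ring)

theorem modeEnergy_freeEvolution_le (t : ℝ) (W : State d) (k : Fin d → ℤ) :
    modeEnergy k (profileCoeff t W k) (velocityCoeff t W k) ≤
      (2 + 2 * t ^ 2) * modeEnergy k (coeff W.fst.toL2 k) (coeff W.snd k) := by
  have hprofile : ‖profileCoeff t W k‖ ^ 2 ≤
      2 * (1 * ‖coeff W.fst.toL2 k‖ ^ 2 + t ^ 2 * ‖coeff W.snd k‖ ^ 2) := by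
    rw [profileCoeff_eq]
    refine (norm_real_combination_sq_le _ _ _ _).trans ?_
    have hcos := Real.cos_sq_le_one (freq k * t)
    have hsinc := sincCoeff_sq_le t k
    gcongr
  have hpotential : 0 ≤ eigenvalue k * ‖coeff W.fst.toL2 k‖ ^ 2 :=
    mul_nonneg (eigenvalue_nonneg k) (sq_nonneg _)
  have hgrowth : 0 ≤ t ^ 2 * ((1 + eigenvalue k) * ‖coeff W.fst.toL2 k‖ ^ 2) :=
    mul_nonneg (sq_nonneg t) (by linarith [sq_nonneg ‖coeff W.fst.toL2 k‖])
  unfold modeEnergy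
  linarith [energy_conservation t W k, sq_nonneg ‖coeff W.snd k‖]

theorem coeff_freeEvolution (t : ℝ) (W : State d) :
    (∀ k, coeff (freeEvolution t W).fst.toL2 k = profileCoeff t W k) ∧
      ∀ k, coeff (freeEvolution t W).snd k = velocityCoeff t W k := by
  have hsummable : Summable fun k => modeEnergy k (profileCoeff t W k) (velocityCoeff t W k) :=
    ((hasSum_modeEnergy W).summable.mul_left (2 + 2 * t ^ 2)).of_nonneg_of_le
      (fun k => modeEnergy_nonneg k _ _) (modeEnergy_freeEvolution_le t W)
  obtain ⟨Z, hfst, hsnd⟩ := exists_state_coeff_eq hsummable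
    (fun k => by
      simp [profileCoeff_eq, coeff_neg_index, freq_neg, sincCoeff_neg, -Complex.ofReal_cos])
    (fun k => by
      simp [velocityCoeff, coeff_neg_index, freq_neg, -Complex.ofReal_cos, -Complex.ofReal_sin])
  have hZ := hasSum_modeState Z
  simp only [hfst, hsnd] at hZ
  rw [freeEvolution, hZ.tsum_eq]
  exact ⟨hfst, hsnd⟩

theorem coeff_freeEvolution_fst (t : ℝ) (W : State d) (k : Fin d → ℤ) :
    coeff (freeEvolution t W).fst.toL2 k = (Real.cos (freq k * t) : ℂ) * coeff W.fst.toL2 k +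
      (sincCoeff t k : ℂ) * coeff W.snd k := (coeff_freeEvolution t W).1 k

theorem coeff_freeEvolution_snd (t : ℝ) (W : State d) (k : Fin d → ℤ) :
    coeff (freeEvolution t W).snd k =
      ((-(freq k * Real.sin (freq k * t)) : ℝ) : ℂ) * coeff W.fst.toL2 k +
        (Real.cos (freq k * t) : ℂ) * coeff W.snd k := (coeff_freeEvolution t W).2 k

theorem modeEnergy_coeff_freeEvolution_le {t R : ℝ} (ht : |t| ≤ R) (W : State d) (k : Fin d → ℤ) :
    modeEnergy k (coeff (freeEvolution t W).fst.toL2 k) (coeff (freeEvolution t W).snd k) ≤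
      (2 + 2 * R ^ 2) * modeEnergy k (coeff W.fst.toL2 k) (coeff W.snd k) := by
  rw [(coeff_freeEvolution t W).1, (coeff_freeEvolution t W).2]
  refine (modeEnergy_freeEvolution_le t W k).trans ?_
  have := sq_le_sq' (neg_le_of_abs_le ht) (le_of_abs_le ht)
  gcongr
  exact modeEnergy_nonneg k _ _

theorem norm_freeEvolution_le (t : ℝ) (W : State d) :
    ‖freeEvolution t W‖ ≤ √(2 + 2 * |t| ^ 2) * ‖W‖ := by
  refine le_of_sq_le_sq ?_ (by positivity)
  rw [mul_pow, Real.sq_sqrt (by positivity)]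
  exact hasSum_le (modeEnergy_coeff_freeEvolution_le le_rfl W) (hasSum_modeEnergy _)
    ((hasSum_modeEnergy W).mul_left _)

theorem freeEvolution_zero (W : State d) : freeEvolution 0 W = W := by
  apply state_ext_coeff <;> intro k
  · simp [coeff_freeEvolution_fst, sincCoeff_zero]
  · simp [coeff_freeEvolution_snd]

theorem freeEvolution_add_time (s t : ℝ) (W : State d) :
    freeEvolution (s + t) W = freeEvolution s (freeEvolution t W) := by
  apply state_ext_coeff <;> intro k <;>
    simp only [coeff_freeEvolution_fst, coeff_freeEvolution_snd, sincCoeff_add, mul_add,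
      Real.cos_add, Real.sin_add, ← freq_mul_sincCoeff] <;>
    push_cast <;> ring

theorem continuous_freeEvolution (W : State d) : Continuous fun t => freeEvolution t W := by
  have hsinc : ∀ k : Fin d → ℤ, Continuous fun t => sincCoeff t k := fun k =>
    continuous_iff_continuousAt.2 fun t => (hasDerivAt_sincCoeff t k).continuousAt
  refine continuous_iff_continuousAt.2 fun t₀ => ?_
  refine tendsto_of_coeff
    ((hasSum_modeEnergy W).summable.mul_left (2 + 2 * (|t₀| + 1) ^ 2)) ?_ (fun k => ?_) fun k => ?_
  · filter_upwards [Metric.ball_mem_nhds t₀ one_pos] with t ht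
    rw [Metric.mem_ball, Real.dist_eq] at ht
    exact modeEnergy_coeff_freeEvolution_le (by linarith [abs_sub_abs_le_abs_sub t t₀]) W
  · simp only [coeff_freeEvolution_fst]
    exact Continuous.tendsto (by fun_prop) t₀
  · simp only [coeff_freeEvolution_snd]
    exact Continuous.tendsto (by fun_prop) t₀

/-- The strongly continuous group `e^{t𝒜}` of the free wave equation. -/
def waveGroup (d : ℕ) : C0Group (State d) where
  op t := LinearMap.mkContinuous
    { toFun := freeEvolution t
      map_add' := fun V W => by
        apply state_ext_coeff <;> intro k <;>
          simp only [WithLp.add_fst, WithLp.add_snd, map_add, coeff_add, coeff_freeEvolution_fst,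
            coeff_freeEvolution_snd] <;>
          ring
      map_smul' := fun c W => by
        apply state_ext_coeff <;> intro k <;>
          simp only [WithLp.smul_fst, WithLp.smul_snd, map_smul, coeff_smul,
            coeff_freeEvolution_fst, coeff_freeEvolution_snd, RingHom.id_apply] <;>
          ring }
    _ (norm_freeEvolution_le t)
  op_zero := ContinuousLinearMap.ext freeEvolution_zero
  op_add s t := ContinuousLinearMap.ext (freeEvolution_add_time s t)
  continuous_op_apply := continuous_freeEvolution

theorem waveGroup_apply (t : ℝ) (W : State d) : waveGroup d t W = freeEvolution t W := rfl

theorem abs_cos_freq_mul_sub_one_le (k : Fin d → ℤ) (t : ℝ) :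
    |Real.cos (freq k * t) - 1| ≤ freq k * |t| := by
  have := Real.abs_cos_sub_cos_le (freq k * t) 0
  rwa [Real.cos_zero, sub_zero, abs_mul, abs_of_nonneg (freq_nonneg k)] at this

theorem norm_freeEvolution_fst_sub_le (t : ℝ) (W : State d) :
    ‖(freeEvolution t W).fst.toL2 - W.fst.toL2‖ ≤ √2 * |t| * ‖W‖ := by
  refine le_of_sq_le_sq ?_ (by positivity)
  rw [mul_pow, mul_pow, sq_abs, Real.sq_sqrt zero_le_two]
  refine hasSum_le (fun k => ?_) (hasSum_norm_coeff_sq _) ((hasSum_modeEnergy W).mul_left _)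
  have hcoeff : coeff ((freeEvolution t W).fst.toL2 - W.fst.toL2) k =
      ((Real.cos (freq k * t) - 1 : ℝ) : ℂ) * coeff W.fst.toL2 k +
        (sincCoeff t k : ℂ) * coeff W.snd k := by
    rw [coeff_sub, coeff_freeEvolution_fst]
    push_cast
    ring
  have hcos : (Real.cos (freq k * t) - 1) ^ 2 ≤ (1 + eigenvalue k) * t ^ 2 := by
    rw [← sq_abs, ← sq_abs t, ← freq_sq]
    exact (pow_le_pow_left₀ (abs_nonneg _) (abs_cos_freq_mul_sub_one_le k t) 2).trans
      (by rw [mul_pow]; gcongr; linarith)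
  rw [hcoeff]
  calc _ ≤ 2 * (_ * _ + _ * _) := norm_real_combination_sq_le _ _ _ _
    _ ≤ 2 * ((1 + eigenvalue k) * t ^ 2 * ‖coeff W.fst.toL2 k‖ ^ 2 +
          t ^ 2 * ‖coeff W.snd k‖ ^ 2) := by
        have hsinc := sincCoeff_sq_le t k
        gcongr
    _ = _ := by unfold modeEnergy; ring

theorem fst_mkState (w : H1 d) (v : L2 d) : (mkState w v).fst = w := rfl

theorem snd_mkState (w : H1 d) (v : L2 d) : (mkState w v).snd = v := rfl

theorem coeff_freeEvolution_slope (t : ℝ) (u : H1 d) (k : Fin d → ℤ) :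
    coeff (t⁻¹ • (freeEvolution t (mkState 0 u.toL2) - mkState 0 u.toL2)).fst.toL2 k =
        ((t⁻¹ * sincCoeff t k : ℝ) : ℂ) * coeff u.toL2 k ∧
      coeff (t⁻¹ • (freeEvolution t (mkState 0 u.toL2) - mkState 0 u.toL2)).snd k =
        ((t⁻¹ * (Real.cos (freq k * t) - 1) : ℝ) : ℂ) * coeff u.toL2 k := by
  constructor <;>
    simp only [WithLp.smul_fst, WithLp.sub_fst, WithLp.smul_snd, WithLp.sub_snd, map_smul, map_sub,
      coeff_smul, coeff_sub, coeff_freeEvolution_fst, coeff_freeEvolution_snd, fst_mkState,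
      snd_mkState, map_zero, coeff_zero] <;>
    push_cast <;> ring

theorem modeEnergy_real_smul_le {k : Fin d → ℤ} {a b : ℝ} (ha : |a| ≤ 1) (hb : |b| ≤ freq k)
    (z : ℂ) : modeEnergy k (a * z) (b * z) ≤ 2 * modeEnergy k z 0 := by
  have ha₂ : a ^ 2 ≤ 1 := (sq_le_one_iff_abs_le_one a).2 ha
  have hb₂ : b ^ 2 ≤ eigenvalue k := by
    rw [← freq_sq]
    exact sq_le_sq' (neg_le_of_abs_le hb) (le_of_abs_le hb)
  simp only [modeEnergy, norm_mul, mul_pow, Complex.norm_real, Real.norm_eq_abs, sq_abs, norm_zero]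
  have hk := eigenvalue_nonneg k
  calc _ ≤ (1 + eigenvalue k) * (1 * ‖z‖ ^ 2) + eigenvalue k * ‖z‖ ^ 2 := by gcongr
    _ ≤ _ := by linarith [sq_nonneg ‖z‖]

theorem tendsto_freeEvolution_slope (u : H1 d) :
    Tendsto (fun t : ℝ => t⁻¹ • (freeEvolution t (mkState 0 u.toL2) - mkState 0 u.toL2))
      (𝓝[>] 0) (𝓝 (mkState u 0)) := by
  have hmul : ∀ {f : ℝ → ℝ} {c : ℝ} (z : ℂ), Tendsto f (𝓝[>] 0) (𝓝 c) →
      Tendsto (fun t => (f t : ℂ) * z) (𝓝[>] 0) (𝓝 (c * z)) := fun z hf =>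
    ((Complex.continuous_ofReal.tendsto _).comp hf).mul_const z
  refine tendsto_of_coeff
    ((hasSum_modeEnergy (mkState u 0)).summable.mul_left 2) ?_ (fun k => ?_) fun k => ?_
  · filter_upwards [self_mem_nhdsWithin] with t ht k
    have ht₀ : (0 : ℝ) < |t| := abs_pos.2 (ne_of_gt ht)
    rw [(coeff_freeEvolution_slope t u k).1, (coeff_freeEvolution_slope t u k).2,
      fst_mkState, snd_mkState, coeff_zero]
    refine modeEnergy_real_smul_le ?_ ?_ _ <;> rw [abs_mul, abs_inv, inv_mul_le_iff₀ ht₀]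
    · simpa only [mul_one] using abs_sincCoeff_le t k
    · simpa only [mul_comm] using abs_cos_freq_mul_sub_one_le k t
  · simp only [fun t => (coeff_freeEvolution_slope t u k).1]
    have hslope := (hasDerivAt_sincCoeff 0 k).tendsto_slope_zero_right
    simp only [zero_add, sincCoeff_zero, sub_zero, mul_zero, Real.cos_zero, smul_eq_mul] at hslope
    simpa only [Complex.ofReal_one, one_mul, fst_mkState] using hmul (coeff u.toL2 k) hslope
  · simp only [fun t => (coeff_freeEvolution_slope t u k).2]
    have hslope := (((hasDerivAt_id' (0 : ℝ)).const_mul (freq k)).cos).tendsto_slope_zero_right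
    simp only [zero_add, mul_zero, Real.cos_zero, Real.sin_zero, neg_zero, zero_mul,
      smul_eq_mul] at hslope
    simpa only [Complex.ofReal_zero, zero_mul, snd_mkState, coeff_zero] using
      hmul (coeff u.toL2 k) hslope

end FreeWave

/-! ### Potentials -/

section Potentials

variable {d : ℕ}

/-- Multiplication of `L²` functions by continuous functions, as a bounded bilinear map. -/
def mulOp (d : ℕ) : C(Torus d, ℝ) →L[ℝ] L2 d →L[ℝ] L2 d :=
  (ContinuousLinearMap.mul ℝ ℝ).holderL volume ∞ 2 2 ∘L ContinuousMap.toLp ∞ volume ℝ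

theorem coeFn_mulOp (g : C(Torus d, ℝ)) (w : L2 d) : mulOp d g w =ᵐ[volume] fun x => g x * w x := by
  filter_upwards [(ContinuousLinearMap.mul ℝ ℝ).coeFn_holder (r := 2)
    (ContinuousMap.toLp ∞ (volume : Measure (Torus d)) ℝ g) w,
    ContinuousMap.coeFn_toLp (p := ∞) (𝕜 := ℝ) (volume : Measure (Torus d)) g] with x hx hg
  exact hx.trans (by rw [hg, ContinuousLinearMap.mul_apply'])

theorem mulL2_eq_mulOp (g : C(Torus d, ℝ)) (w : L2 d) : mulL2 g w = mulOp d g w :=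
  Lp.ext ((MemLp.coeFn_toLp _).trans (coeFn_mulOp g w).symm)

theorem mulOp_mul (f g : C(Torus d, ℝ)) (w : L2 d) :
    mulOp d (f * g) w = mulOp d f (mulOp d g w) := by
  apply Lp.ext
  filter_upwards [coeFn_mulOp (f * g) w, coeFn_mulOp g w, coeFn_mulOp f (mulOp d g w)]
    with x hfg hg hf
  rw [hfg, hf, hg, ContinuousMap.mul_apply, mul_assoc]

theorem mulOp_one (w : L2 d) : mulOp d 1 w = w := by
  apply Lp.ext
  filter_upwards [coeFn_mulOp 1 w] with x hx
  rw [hx, ContinuousMap.one_apply, one_mul]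

theorem norm_toL2_le (w : H1 d) : ‖w.toL2‖ ≤ ‖w‖ := by
  refine le_of_sq_le_sq ?_ (norm_nonneg _)
  rw [H1.norm_sq]
  exact le_add_of_nonneg_right (tsum_nonneg fun k => mul_nonneg (eigenvalue_nonneg k) (sq_nonneg _))

/-- The bounded map `(w, v) ↦ w` from states to `L²`. -/
def profileL2 (d : ℕ) : State d →L[ℝ] L2 d :=
  (H1.toL2.mkContinuous 1 fun w => by simpa only [one_mul] using norm_toL2_le w) ∘L
    WithLp.fstL 2 ℝ (H1 d) (L2 d)

/-- The isometry `v ↦ (0, v)` from `L²` to states. -/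
def ofVelocity (d : ℕ) : L2 d →L[ℝ] State d :=
  (WithLp.prodContinuousLinearEquiv 2 ℝ (H1 d) (L2 d)).symm ∘L
    ContinuousLinearMap.inr ℝ (H1 d) (L2 d)

/-- The bounded operator `(w, v) ↦ (0, f w)`, as a function of `f`. -/
def potentialOp (d : ℕ) : C(Torus d, ℝ) →L[ℝ] State d →L[ℝ] State d :=
  (ofVelocity d).postcomp (State d) ∘L (profileL2 d).precomp (L2 d) ∘L mulOp d

theorem potentialOp_apply (f : C(Torus d, ℝ)) (W : State d) :
    potentialOp d f W = mkState 0 (mulOp d f W.fst.toL2) := rfl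

theorem potentialOp_mul_potentialOp (f g : C(Torus d, ℝ)) :
    potentialOp d f * potentialOp d g = 0 := by
  ext1 W
  simp only [mul_apply_eq_comp, potentialOp_apply, fst_mkState, map_zero]
  rfl

/-- The operator `∑_j q_j μ_j ℬ`, as a function of `q`. -/
def controlOp (d : ℕ) : (ControlIndex d → ℝ) →ₗ[ℝ] State d →L[ℝ] State d :=
  (potentialOp d).toLinearMap ∘ₗ Fintype.linearCombination ℝ lowMode

theorem controlOp_apply (q : ControlIndex d → ℝ) :
    controlOp d q = potentialOp d (controlFunction q) := rfl

theorem isSolution_iff_isMild {τ : ℝ} {p : ℝ → ControlIndex d → ℝ} {W₀ : State d}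
    {W : ℝ → State d} :
    IsSolution τ p W₀ W ↔ IsMild (waveGroup d) τ (fun s => controlOp d (p s)) W₀ W := by
  simp only [IsSolution, IsMild, waveGroup_apply, controlOp_apply, potentialOp_apply,
    controlOperator, mulL2_eq_mulOp]

end Potentials

/-! ### Kicks -/

section Kicks

variable {d : ℕ}

/-- The potentials `f` for which the instantaneous kick `(w, v) ↦ (w, v + f w)` can be approximated
in arbitrarily small time. -/
def kickable (d : ℕ) : AddSubmonoid C(Torus d, ℝ) where
  carrier := {f | 1 + potentialOp d f ∈ smallTimeReachable (waveGroup d) (controlOp d)}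
  zero_mem' := by
    simpa only [mem_ofPred_eq, map_zero, add_zero] using one_mem (smallTimeReachable _ _)
  add_mem' {f g} hf hg := by
    have := (smallTimeReachable (waveGroup d) (controlOp d)).mul_mem hf hg
    simpa only [mem_ofPred_eq, mul_add, add_mul, one_mul, mul_one, potentialOp_mul_potentialOp,
      zero_add, add_zero, map_add, add_assoc] using! this

theorem mem_kickable {f : C(Torus d, ℝ)} :
    f ∈ kickable d ↔ 1 + potentialOp d f ∈ smallTimeReachable (waveGroup d) (controlOp d) := Iff.rfl

theorem isClosed_kickable : IsClosed (kickable d : Set C(Torus d, ℝ)) :=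
  isClosed_smallTimeReachable.preimage (continuous_const.add (potentialOp d).continuous)

theorem controlFunction_mem_kickable (q : ControlIndex d → ℝ) : controlFunction q ∈ kickable d :=
  one_add_mem_smallTimeReachable (potentialOp_mul_potentialOp _ _)

theorem smul_lowMode_mem_kickable (c : ℝ) (j : ControlIndex d) : c • lowMode j ∈ kickable d := by
  convert! controlFunction_mem_kickable (Pi.single j c) using 1
  exact (Fintype.linearCombination_apply_single ℝ lowMode j c).symm

/-- The continuous functions `g` such that `g w ∈ H¹` for all `w ∈ H¹`. -/
def h1Multiplier (d : ℕ) : Subalgebra ℝ C(Torus d, ℝ) where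
  carrier := {g | ∀ w : H1 d, mulOp d g w.toL2 ∈ h1Submodule d}
  mul_mem' {f g} hf hg w := by
    rw [mulOp_mul]
    exact hf ⟨_, hg w⟩
  add_mem' hf hg w := by
    rw [map_add]
    exact add_mem (hf w) (hg w)
  algebraMap_mem' c w := by
    rw [Algebra.algebraMap_eq_smul_one, map_smul, _root_.smul_apply, mulOp_one]
    exact Submodule.smul_mem _ c w.2

theorem neg_mul_self_mem_kickable {f : C(Torus d, ℝ)} (hf : f ∈ h1Multiplier d)
    (hk : ∀ c : ℝ, c • f ∈ kickable d) : -(f * f) ∈ kickable d := by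
  rw [mem_kickable, map_neg, ← sub_eq_add_neg]
  refine one_sub_mem_smallTimeReachable (potentialOp_mul_potentialOp f f)
    (fun c => by simpa only [mem_kickable, map_smul] using hk c) (fun x => ?_) fun x => ?_
  · obtain ⟨u, hu⟩ : ∃ u : H1 d, u.toL2 = mulOp d f x.fst.toL2 := ⟨⟨_, hf x.fst⟩, rfl⟩
    refine ⟨mkState u 0, ?_, ?_⟩
    · simpa only [potentialOp_apply, ← hu, waveGroup_apply] using tendsto_freeEvolution_slope u
    · rw [potentialOp_apply, potentialOp_apply, fst_mkState, hu, mulOp_mul]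
  · refine ⟨‖ofVelocity d ∘L mulOp d f‖ * (√2 * ‖x‖), fun t ht => ?_⟩
    have hfree := norm_freeEvolution_fst_sub_le t x
    rw [abs_of_pos ht] at hfree
    calc _ ≤ ‖ofVelocity d ∘L mulOp d f‖ * ‖(freeEvolution t x).fst.toL2 - x.fst.toL2‖ := by
          simpa only [potentialOp_apply] using! (ofVelocity d ∘L mulOp d f).le_opNorm _
      _ ≤ ‖ofVelocity d ∘L mulOp d f‖ * (√2 * t * ‖x‖) := by gcongr
      _ = _ := by ring

/-- The multipliers of `H¹` all of whose real multiples are potentials of approximable kicks. -/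
def kickSpace (d : ℕ) : Submodule ℝ C(Torus d, ℝ) where
  carrier := {f | f ∈ h1Multiplier d ∧ ∀ c : ℝ, c • f ∈ kickable d}
  zero_mem' := ⟨zero_mem _, fun c => by simpa only [smul_zero] using zero_mem (kickable d)⟩
  add_mem' hf hg :=
    ⟨add_mem hf.1 hg.1, fun c => by simpa only [smul_add] using add_mem (hf.2 c) (hg.2 c)⟩
  smul_mem' c f hf :=
    ⟨Subalgebra.smul_mem _ hf.1 c, fun b => by simpa only [smul_smul] using hf.2 (b * c)⟩

theorem mem_kickable_of_mem_kickSpace {f : C(Torus d, ℝ)} (hf : f ∈ kickSpace d) :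
    f ∈ kickable d := by
  simpa only [one_smul] using hf.2 1

theorem neg_smul_mul_self_mem_kickable {f : C(Torus d, ℝ)} (hf : f ∈ kickSpace d) {c : ℝ}
    (hc : 0 ≤ c) : -(c • (f * f)) ∈ kickable d := by
  have hroot := (kickSpace d).smul_mem (√c) hf
  have := neg_mul_self_mem_kickable hroot.1 hroot.2
  rwa [smul_mul_smul_comm, Real.mul_self_sqrt hc] at this

theorem mul_self_mem_kickSpace {f g : C(Torus d, ℝ)} (hf : f ∈ kickSpace d) (hg : g ∈ kickSpace d)
    (hfg : f * f + g * g ∈ kickSpace d) : f * f ∈ kickSpace d := by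
  refine ⟨mul_mem hf.1 hf.1, fun c => ?_⟩
  rcases le_total c 0 with hc | hc
  · simpa only [neg_smul, neg_neg] using neg_smul_mul_self_mem_kickable hf (neg_nonneg.2 hc)
  · simpa only [smul_add, add_neg_cancel_right] using
      add_mem (hfg.2 c) (neg_smul_mul_self_mem_kickable hg hc)

theorem mul_mem_kickSpace {f g : C(Torus d, ℝ)} (hf : f ∈ kickSpace d) (hg : g ∈ kickSpace d)
    (hff : f * f ∈ kickSpace d) (hgg : g * g ∈ kickSpace d) : f * g ∈ kickSpace d := by
  refine ⟨mul_mem hf.1 hg.1, fun c => ?_⟩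
  have hsum : f + (-c / 2) • g ∈ kickSpace d := add_mem hf (Submodule.smul_mem _ _ hg)
  have hsquares : f * f + (-c / 2) ^ 2 • (g * g) ∈ kickSpace d :=
    add_mem hff (Submodule.smul_mem _ _ hgg)
  convert! add_mem (mem_kickable_of_mem_kickSpace hsquares)
    (neg_mul_self_mem_kickable hsum.1 hsum.2) using 1
  ext x
  simp only [ContinuousMap.smul_apply, ContinuousMap.mul_apply, ContinuousMap.add_apply,
    ContinuousMap.neg_apply, smul_eq_mul]
  ring

end Kicks

/-! ### Trigonometric potentials -/

section Trigonometric

variable {d : ℕ}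

/-- The real part of a complex continuous function, as a bounded operator. -/
abbrev reMap (d : ℕ) : C(Torus d, ℂ) →L[ℝ] C(Torus d, ℝ) :=
  Complex.reCLM.compLeftContinuous ℝ (Torus d)

/-- The trigonometric function `Re (a e^{i k·x})`. -/
def trig (k : Fin d → ℤ) (a : ℂ) : C(Torus d, ℝ) := reMap d (a • monomial k)

theorem trig_apply (k : Fin d → ℤ) (a : ℂ) (x : Torus d) : trig k a x = (a * monomial k x).re := rfl

theorem eq_top_of_forall_trig_mem {K : Submodule ℝ C(Torus d, ℝ)}
    (hK : IsClosed (K : Set C(Torus d, ℝ))) (htrig : ∀ k a, trig k a ∈ K) : K = ⊤ := by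
  let N : Submodule ℂ C(Torus d, ℂ) :=
    { carrier := {g | ∀ a : ℂ, reMap d (a • g) ∈ K}
      zero_mem' := fun a => by simpa only [smul_zero, map_zero] using zero_mem K
      add_mem' := fun hg hh a => by simpa only [smul_add, map_add] using add_mem (hg a) (hh a)
      smul_mem' := fun c g hg a => by simpa only [smul_smul] using hg (a * c) }
  have hclosed : IsClosed (N : Set C(Torus d, ℂ)) := by
    change IsClosed {g | ∀ a : ℂ, reMap d (a • g) ∈ K}
    rw [ofPred_forall]
    exact isClosed_iInter fun a =>
      hK.preimage ((reMap d).continuous.comp (continuous_const_smul a))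
  have hN : N = ⊤ := top_le_iff.1 <| topologicalClosure_span_monomial.ge.trans <|
    Submodule.topologicalClosure_minimal _
      (Submodule.span_le.2 (range_subset_iff.2 htrig)) hclosed
  refine eq_top_iff.2 fun f _ => ?_
  have hf : Complex.ofRealCLM.compLeftContinuous ℝ (Torus d) f ∈ N := hN ▸ Submodule.mem_top
  simpa only [one_smul] using! hf 1

theorem conj_eigenfunction_mul_monomial (k l : Fin d → ℤ) (x : Torus d) :
    conj (eigenfunction k x) * monomial l x = conj (eigenfunction (k - l) x) := by
  rw [conj_eigenfunction, conj_eigenfunction, eigenfunction_eq_smul_monomial,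
    eigenfunction_eq_smul_monomial, ContinuousMap.smul_apply, ContinuousMap.smul_apply,
    smul_mul_assoc, ← monomial_add, neg_sub, neg_add_eq_sub]

theorem integrable_conj_eigenfunction_mul (w : L2 d) (k : Fin d → ℤ) :
    Integrable fun x => conj (eigenfunction k x) * ((w x : ℝ) : ℂ) := by
  refine (L2.integrable_inner (𝕜 := ℂ) (eigenLp k) (complexify w)).congr ?_
  filter_upwards [coeFn_eigenLp k, coeFn_complexify w] with x hk hw
  rw [hk, hw, RCLike.inner_apply, mul_comm]

theorem coeff_mulOp_trig (l : Fin d → ℤ) (a : ℂ) (w : L2 d) (k : Fin d → ℤ) :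
    coeff (mulOp d (trig l a) w) k = a / 2 * coeff w (k - l) + conj a / 2 * coeff w (k + l) := by
  rw [coeff, coeff, coeff, ← integral_const_mul, ← integral_const_mul,
    ← integral_add ((integrable_conj_eigenfunction_mul w _).const_mul _)
      ((integrable_conj_eigenfunction_mul w _).const_mul _)]
  refine integral_congr_ae ?_
  filter_upwards [coeFn_mulOp (trig l a) w] with x hx
  rw [hx, trig_apply, Complex.ofReal_mul, Complex.re_eq_add_conj, map_mul, ← monomial_neg,
    ← conj_eigenfunction_mul_monomial k l, ← sub_neg_eq_add k l,
    ← conj_eigenfunction_mul_monomial k (-l)]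
  ring

theorem eigenvalue_add_le (k l : Fin d → ℤ) :
    eigenvalue (k + l) ≤ 2 * (eigenvalue k + eigenvalue l) := by
  simp only [eigenvalue, ← Finset.sum_add_distrib, Finset.mul_sum, Pi.add_apply, Int.cast_add]
  exact Finset.sum_le_sum fun i _ => add_sq_le

theorem summable_eigenvalue_mul_shift (w : H1 d) (l : Fin d → ℤ) :
    Summable fun k => eigenvalue k * ‖coeff w.toL2 (k + l)‖ ^ 2 := by
  have hshift := (Equiv.addRight l).summable_iff.2 <|
    (w.summable.add ((hasSum_norm_coeff_sq w.toL2).summable.mul_left (eigenvalue l))).mul_left 2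
  refine hshift.of_nonneg_of_le (fun k => mul_nonneg (eigenvalue_nonneg k) (sq_nonneg _))
    fun k => ?_
  have hk : eigenvalue k ≤ 2 * (eigenvalue (k + l) + eigenvalue l) := by
    simpa only [add_neg_cancel_right, eigenvalue_neg] using eigenvalue_add_le (k + l) (-l)
  simp only [Function.comp_apply, Equiv.coe_addRight, ← add_mul, ← mul_assoc]
  gcongr

theorem trig_mem_h1Multiplier (l : Fin d → ℤ) (a : ℂ) : trig l a ∈ h1Multiplier d := by
  intro w
  have hshift := ((summable_eigenvalue_mul_shift w (-l)).add
    (summable_eigenvalue_mul_shift w l)).mul_left (‖a‖ ^ 2 / 2)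
  refine hshift.of_nonneg_of_le (fun k => mul_nonneg (eigenvalue_nonneg k) (sq_nonneg _))
    fun k => ?_
  have hk := eigenvalue_nonneg k
  calc eigenvalue k * ‖coeff (mulOp d (trig l a) w.toL2) k‖ ^ 2
      ≤ eigenvalue k *
          (‖a‖ / 2 * ‖coeff w.toL2 (k + -l)‖ + ‖a‖ / 2 * ‖coeff w.toL2 (k + l)‖) ^ 2 := by
        rw [coeff_mulOp_trig, ← sub_eq_add_neg]
        gcongr
        refine (norm_add_le _ _).trans_eq ?_
        simp only [norm_mul, norm_div, Complex.norm_conj, Complex.norm_ofNat]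
    _ ≤ eigenvalue k * (2 * ((‖a‖ / 2 * ‖coeff w.toL2 (k + -l)‖) ^ 2 +
          (‖a‖ / 2 * ‖coeff w.toL2 (k + l)‖) ^ 2)) := by
        gcongr
        exact add_sq_le
    _ = _ := by ring

theorem trig_neg (k : Fin d → ℤ) (a : ℂ) : trig (-k) a = trig k (conj a) := by
  ext x
  rw [trig_apply, trig_apply, monomial_neg, ← Complex.conj_re, map_mul, Complex.conj_conj]

theorem trig_zero (a : ℂ) : trig (0 : Fin d → ℤ) a = a.re • lowMode (.inl ()) := by
  ext x
  simp [trig_apply, monomial_apply, lowMode]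

theorem trig_single (i : Fin d) (a : ℂ) : trig (Pi.single i 1) a =
    a.re • lowMode (.inr (.inl i)) + (-a.im) • lowMode (.inr (.inr i)) := by
  ext x
  have hmonomial : monomial (Pi.single i 1) x = fourier 1 (x i) := by
    rw [monomial_apply, Finset.prod_eq_single i, Pi.single_eq_same]
    · intro j _ hj
      rw [Pi.single_eq_of_ne hj, fourier_zero]
    · exact fun hi => absurd (Finset.mem_univ i) hi
  simp only [trig_apply, hmonomial, lowMode, Complex.mul_re, ContinuousMap.add_apply,
    ContinuousMap.smul_apply, ContinuousMap.coe_mk, smul_eq_mul]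
  ring

theorem trig_add (k l : Fin d → ℤ) (a : ℂ) : trig (k + l) a =
    trig k a * trig l 1 - trig k (-Complex.I * a) * trig l (-Complex.I) := by
  ext x
  simp only [trig_apply, monomial_add, ContinuousMap.sub_apply, ContinuousMap.mul_apply,
    Complex.mul_re, Complex.mul_im, Complex.neg_re, Complex.neg_im, Complex.I_re, Complex.I_im,
    Complex.one_re, Complex.one_im]
  ring

theorem trig_mul_self_add (k : Fin d → ℤ) (a : ℂ) :
    trig k a * trig k a + trig k (-Complex.I * a) * trig k (-Complex.I * a) =
      trig 0 ((‖a‖ ^ 2 : ℝ) : ℂ) := by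
  ext x
  have hnorm : ‖a * monomial k x‖ ^ 2 = ‖a‖ ^ 2 := by rw [norm_mul, norm_monomial_apply, mul_one]
  have him : (-Complex.I * a * monomial k x).re = (a * monomial k x).im := by
    simp [mul_assoc]
  rw [trig_zero, ContinuousMap.add_apply, ContinuousMap.mul_apply, ContinuousMap.mul_apply,
    trig_apply, trig_apply, him, ← Complex.normSq_apply, Complex.normSq_eq_norm_sq, hnorm]
  exact (mul_one _).symm

theorem trig_zero_mem_kickSpace (a : ℂ) : trig (0 : Fin d → ℤ) a ∈ kickSpace d := by
  refine ⟨trig_mem_h1Multiplier 0 a, fun c => ?_⟩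
  rw [trig_zero, smul_smul]
  exact smul_lowMode_mem_kickable _ _

theorem trig_single_mem_kickSpace (i : Fin d) (a : ℂ) : trig (Pi.single i 1) a ∈ kickSpace d := by
  refine ⟨trig_mem_h1Multiplier _ a, fun c => ?_⟩
  rw [trig_single, smul_add, smul_smul, smul_smul]
  exact add_mem (smul_lowMode_mem_kickable _ _) (smul_lowMode_mem_kickable _ _)

theorem trig_mul_self_mem_kickSpace {k : Fin d → ℤ} (hk : ∀ a, trig k a ∈ kickSpace d) (a : ℂ) :
    trig k a * trig k a ∈ kickSpace d := by
  refine mul_self_mem_kickSpace (hk a) (hk (-Complex.I * a)) ?_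
  rw [trig_mul_self_add]
  exact trig_zero_mem_kickSpace _

/-- The frequencies `k` for which all functions `Re (a e^{i k·x})` belong to `kickSpace d`. -/
def kickFrequencies (d : ℕ) : AddSubgroup (Fin d → ℤ) where
  carrier := {k | ∀ a, trig k a ∈ kickSpace d}
  zero_mem' := trig_zero_mem_kickSpace
  neg_mem' hk a := by
    rw [trig_neg]
    exact hk _
  add_mem' hk hl a := by
    rw [trig_add]
    exact sub_mem
      (mul_mem_kickSpace (hk _) (hl _) (trig_mul_self_mem_kickSpace hk _)
        (trig_mul_self_mem_kickSpace hl _))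
      (mul_mem_kickSpace (hk _) (hl _) (trig_mul_self_mem_kickSpace hk _)
        (trig_mul_self_mem_kickSpace hl _))

theorem trig_mem_kickSpace (k : Fin d → ℤ) (a : ℂ) : trig k a ∈ kickSpace d := by
  suffices hk : k ∈ kickFrequencies d from hk a
  rw [pi_eq_sum_univ k]
  refine sum_mem fun i _ => ?_
  have hi : (Pi.single i 1 : Fin d → ℤ) ∈ kickFrequencies d := trig_single_mem_kickSpace i
  convert zsmul_mem hi (k i) using 3 with j
  rw [Pi.single_apply]
  simp only [eq_comm]

theorem topologicalClosure_kickSpace : (kickSpace d).topologicalClosure = ⊤ :=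
  eq_top_of_forall_trig_mem (Submodule.isClosed_topologicalClosure _) fun k a =>
    Submodule.le_topologicalClosure _ (trig_mem_kickSpace k a)

theorem kickable_eq_top : kickable d = ⊤ := by
  refine top_le_iff.1 fun f _ => ?_
  have hf : f ∈ (kickSpace d).topologicalClosure := topologicalClosure_kickSpace ▸ Submodule.mem_top
  exact closure_minimal (fun g => mem_kickable_of_mem_kickSpace) isClosed_kickable hf

end Trigonometric

/-! ### Profiles in dimension at most one -/

section LowDimension

variable {d : ℕ}

theorem summable_inv_one_add_eigenvalue (hd : d < 2) :
    Summable fun k : Fin d → ℤ => (1 + eigenvalue k)⁻¹ := by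
  interval_cases d
  · exact Summable.of_finite
  · have hbound : Summable fun n : ℤ => 1 / (n : ℝ) ^ 2 + if n = 0 then 1 else 0 :=
      (Real.summable_one_div_int_pow.2 one_lt_two).add (hasSum_ite_eq 0 1).summable
    rw [← (Equiv.funUnique (Fin 1) ℤ).symm.summable_iff]
    refine hbound.of_nonneg_of_le (fun n => inv_nonneg.2 ?_) fun n => ?_
    · exact add_nonneg zero_le_one (eigenvalue_nonneg _)
    · have heigenvalue : eigenvalue ((Equiv.funUnique (Fin 1) ℤ).symm n) = (n : ℝ) ^ 2 := by
        simp [eigenvalue]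
      rw [Function.comp_apply, heigenvalue]
      rcases eq_or_ne n 0 with rfl | hn
      · simp
      · rw [if_neg hn, add_zero, one_div]
        exact inv_anti₀ (by positivity) (le_add_of_nonneg_left zero_le_one)

theorem summable_norm_coeff (hd : d < 2) (w : H1 d) : Summable fun k => ‖coeff w.toL2 k‖ := by
  have henergy : Summable fun k => (1 + eigenvalue k) * ‖coeff w.toL2 k‖ ^ 2 := by
    simpa only [add_mul, one_mul] using (hasSum_norm_coeff_sq w.toL2).summable.add w.summable
  refine ((summable_inv_one_add_eigenvalue hd).add henergy).of_nonneg_of_le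
    (fun k => norm_nonneg _) fun k => ?_
  set r := 1 + eigenvalue k
  set c := ‖coeff w.toL2 k‖
  have hr : 0 < r := add_pos_of_pos_of_nonneg one_pos (eigenvalue_nonneg k)
  have : 0 ≤ c := norm_nonneg _
  have hgap : r⁻¹ + r * c ^ 2 - c = r⁻¹ * ((r * c - 1) ^ 2 + r * c) := by
    field_simp
    ring
  rw [← sub_nonneg, hgap]
  positivity

theorem norm_eigenfunction_le (k : Fin d → ℤ) :
    ‖eigenfunction k‖ ≤ (2 * Real.pi) ^ (-(d : ℝ) / 2) := by
  have hnonneg : 0 ≤ (2 * Real.pi) ^ (-(d : ℝ) / 2) := Real.rpow_nonneg Real.two_pi_pos.le _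
  refine (ContinuousMap.norm_le _ hnonneg).2 fun x => ?_
  rw [eigenfunction_eq_smul_monomial, ContinuousMap.smul_apply, norm_smul, norm_monomial_apply,
    mul_one, Complex.norm_real, Real.norm_of_nonneg hnonneg]

theorem exists_continuous_ae_eq (hd : d < 2) (w : H1 d) :
    ∃ g : C(Torus d, ℝ), w.toL2 =ᵐ[volume] g := by
  obtain ⟨g, hg⟩ : Summable fun k => coeff w.toL2 k • (eigenfunction k : C(Torus d, ℂ)) := by
    refine Summable.of_norm_bounded
      ((summable_norm_coeff hd w).mul_right ((2 * Real.pi) ^ (-(d : ℝ) / 2))) fun k => ?_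
    rw [norm_smul]
    gcongr
    exact norm_eigenfunction_le k
  have hsum := hg.mapL (ContinuousMap.toLp (E := ℂ) 2 (volume : Measure (Torus d)) ℂ)
  simp only [map_smul] at hsum
  have htoLp := hsum.unique (hasSum_coeff_smul_eigenLp w.toL2)
  refine ⟨reMap d g, ?_⟩
  filter_upwards [coeFn_complexify w.toL2, ContinuousMap.coeFn_toLp (p := 2) (E := ℂ) (𝕜 := ℂ)
    (volume : Measure (Torus d)) g] with x hw hgx
  have hx : g x = w.toL2 x := by rw [← hgx, htoLp, hw]
  exact (congrArg Complex.re hx).symm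

theorem memLp_mul_of_lt_two (hd : d < 2) (w : H1 d) (φ : L2 d) :
    MemLp (fun x => w.toL2 x * φ x) 2 (volume : Measure (Torus d)) := by
  obtain ⟨g, hg⟩ := exists_continuous_ae_eq hd w
  refine (Lp.memLp (mulOp d g φ)).ae_eq ?_
  filter_upwards [coeFn_mulOp g φ, hg] with x hmul hgx
  rw [hmul, hgx]

end LowDimension

/-! ### Approximation by multiples of a profile -/

section Multiples

open scoped BoundedContinuousFunction NNReal

theorem ae_eq_zero_of_forall_integral_smul_eq_zero {X E : Type*} [TopologicalSpace X]
    [HasOuterApproxClosed X] [MeasurableSpace X] [BorelSpace X] [NormedAddCommGroup E]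
    [NormedSpace ℝ E] [CompleteSpace E] {μ : Measure X} {f : X → E} (hf : Integrable f μ)
    (h : ∀ g : X →ᵇ ℝ≥0, ∫ x, (g x : ℝ) • f x ∂μ = 0) : f =ᵐ[μ] 0 := by
  refine ae_eq_zero_of_forall_setIntegral_isClosed_eq_zero hf fun s hs => ?_
  have hlim : Tendsto (fun n => ∫ x, (hs.apprSeq n x : ℝ) • f x ∂μ) atTop
      (𝓝 (∫ x, s.indicator f x ∂μ)) := by
    refine tendsto_integral_of_dominated_convergence (fun x => ‖f x‖) (fun n => ?_) hf.norm
      (fun n => .of_forall fun x => ?_) (.of_forall fun x => ?_)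
    · exact (NNReal.continuous_coe.comp (hs.apprSeq n).continuous).aestronglyMeasurable.smul
        hf.aestronglyMeasurable
    · rw [norm_smul, Real.norm_of_nonneg NNReal.zero_le_coe]
      exact mul_le_of_le_one_left (norm_nonneg _)
        (NNReal.coe_le_one.2 (HasOuterApproxClosed.apprSeq_apply_le_one hs n x))
    · have hx : Tendsto (fun n => (hs.apprSeq n x : ℝ)) atTop
          (𝓝 (s.indicator (fun _ => (1 : ℝ≥0)) x : ℝ≥0)) :=
        NNReal.tendsto_coe.2 (tendsto_pi_nhds.1 (HasOuterApproxClosed.tendsto_apprSeq hs) x)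
      by_cases hxs : x ∈ s <;> simpa [hxs] using hx.smul_const (f x)
  simpa only [h, tendsto_const_nhds_iff, integral_indicator hs.measurableSet, eq_comm] using hlim

variable {d : ℕ}

theorem inner_mulOp (g : C(Torus d, ℝ)) (v w : L2 d) :
    inner ℝ (mulOp d g w) v = ∫ x, g x * (w x * v x) := by
  rw [L2.inner_def]
  refine integral_congr_ae ?_
  filter_upwards [coeFn_mulOp g w] with x hx
  rw [hx, RCLike.inner_apply', conj_trivial, mul_assoc]

theorem ae_mul_eq_zero_of_forall_inner_mulOp_eq_zero {v w : L2 d}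
    (h : ∀ g, inner ℝ (mulOp d g w) v = 0) : (fun x => w x * v x) =ᵐ[volume] 0 := by
  have hint : Integrable fun x => w x * v x := (Lp.memLp w).integrable_mul (Lp.memLp v)
  refine ae_eq_zero_of_forall_integral_smul_eq_zero hint fun g => ?_
  exact (inner_mulOp ⟨fun x => (g x : ℝ), by fun_prop⟩ v w).symm.trans (h _)

theorem toLp_mul_mem_closure_range_mulOp (w : L2 d) {φ : Torus d → ℝ}
    (h : MemLp (fun x => w x * φ x) 2 volume) :
    h.toLp ∈ closure (range fun g => mulOp d g w) := by
  let K : Submodule ℝ (L2 d) := ((mulOp d).flip w).range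
  suffices hK : h.toLp ∈ K.topologicalClosure from hK
  rw [← K.orthogonal_orthogonal_eq_closure, Submodule.mem_orthogonal]
  intro v hv
  have hvw := ae_mul_eq_zero_of_forall_inner_mulOp_eq_zero fun g =>
    Submodule.inner_right_of_mem_orthogonal (LinearMap.mem_range_self _ g) hv
  rw [L2.inner_def]
  refine integral_eq_zero_of_ae ?_
  filter_upwards [h.coeFn_toLp, hvw] with x hx hvwx
  rw [hx, RCLike.inner_apply', conj_trivial, ← mul_assoc, mul_comm (v x), hvwx, Pi.zero_apply,
    zero_mul]

end Multiples

/-! ### Attaining the velocity increment -/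

section Attainability

variable {d : ℕ}

theorem add_ofVelocity_mem_closure_reachableSet {T : ℝ} (hT : 0 < T) (x : State d) {v : L2 d}
    (hv : v ∈ closure (range fun g => mulOp d g x.fst.toL2)) :
    x + ofVelocity d v ∈ closure (reachableSet (waveGroup d) (controlOp d) T x) := by
  refine closure_minimal (t := (fun v => x + ofVelocity d v) ⁻¹'
    closure (reachableSet (waveGroup d) (controlOp d) T x)) (range_subset_iff.2 fun g => ?_)
    (isClosed_closure.preimage (by fun_prop)) hv
  have hg : g ∈ kickable d := kickable_eq_top ▸ AddSubmonoid.mem_top g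
  exact mem_kickable.1 hg T hT x

theorem exists_isSolution_of_mem_reachableSet {T : ℝ} {x y : State d}
    (hy : y ∈ reachableSet (waveGroup d) (controlOp d) T x) :
    ∃ τ ∈ Ico 0 T, ∃ p : ℝ → ControlIndex d → ℝ, IsPiecewiseConstant τ p ∧
      (∃ W, IsSolution τ p x W) ∧ ∀ W, IsSolution τ p x W → W τ = y := by
  obtain ⟨τ, hτ, F, ⟨hτ₀, p, hp, hF⟩, rfl⟩ := hy
  obtain ⟨V, hV, hVF⟩ := hF x
  refine ⟨τ, hτ, p, hp, ⟨V, isSolution_iff_isMild.2 hV⟩, fun W hW => ?_⟩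
  rw [← hVF]
  exact (isSolution_iff_isMild.1 hW).unique hV hτ₀ (hp.comp _)

end Attainability

end TorusWave

end

theorem mainTheorem5_general (d : ℕ) (w₀ : TorusWave.H1 d) (v₀ : TorusWave.L2 d)
    (φ : TorusWave.Torus d → ℝ)
    (h : MemLp (fun x => w₀.toL2 x * φ x) 2 (volume : Measure (TorusWave.Torus d))) :
    ∀ ε > (0 : ℝ), ∀ T > (0 : ℝ), ∃ τ ∈ Ico 0 T, ∃ p : ℝ → TorusWave.ControlIndex d → ℝ,
      TorusWave.IsPiecewiseConstant τ p ∧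
      (∃ W, TorusWave.IsSolution τ p (TorusWave.mkState w₀ v₀) W) ∧
      ∀ W, TorusWave.IsSolution τ p (TorusWave.mkState w₀ v₀) W →
        ‖W τ - TorusWave.mkState w₀ (v₀ + h.toLp)‖ < ε := by
  intro ε hε T hT
  have htarget : TorusWave.mkState w₀ v₀ + TorusWave.ofVelocity d h.toLp =
      TorusWave.mkState w₀ (v₀ + h.toLp) :=
    congrArg (fun w => TorusWave.mkState w (v₀ + h.toLp)) (add_zero w₀)
  have hclosure := TorusWave.add_ofVelocity_mem_closure_reachableSet hT
    (TorusWave.mkState w₀ v₀) (TorusWave.toLp_mul_mem_closure_range_mulOp w₀.toL2 h)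
  obtain ⟨y, hy, hyε⟩ := Metric.mem_closure_iff.1 (htarget ▸ hclosure) ε hε
  obtain ⟨τ, hτ, p, hp, hexists, hW⟩ := TorusWave.exists_isSolution_of_mem_reachableSet hy
  refine ⟨τ, hτ, p, hp, hexists, fun W hsol => ?_⟩
  rwa [hW W hsol, ← dist_eq_norm, dist_comm]

theorem mainTheorem5 (d : ℕ) (w₀ : TorusWave.H1 d) (v₀ φ : TorusWave.L2 d)
    (hφ : 2 ≤ d → MemLp (fun x => w₀.toL2 x * φ x) 2 (volume : Measure (TorusWave.Torus d))) :
    ∃ h : MemLp (fun x => w₀.toL2 x * φ x) 2 (volume : Measure (TorusWave.Torus d)),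
      ∀ ε > (0 : ℝ), ∀ T > (0 : ℝ), ∃ τ ∈ Ico 0 T, ∃ p : ℝ → TorusWave.ControlIndex d → ℝ,
        TorusWave.IsPiecewiseConstant τ p ∧
        (∃ W, TorusWave.IsSolution τ p (TorusWave.mkState w₀ v₀) W) ∧
        ∀ W, TorusWave.IsSolution τ p (TorusWave.mkState w₀ v₀) W →
          ‖W τ - TorusWave.mkState w₀ (v₀ + h.toLp)‖ < ε :=
  have h := (lt_or_ge d 2).elim (TorusWave.memLp_mul_of_lt_two · w₀ φ) hφ
  ⟨h, mainTheorem5_general d w₀ v₀ φ h⟩
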